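/- All graphs are finite and simple. For a graph $G$ let $m(G)$ be the largest integer $k$ such that at least $k$ vertices of $G$ have degree at least $k-1$; a vertex is dense if its degree is at least $m(G)-1$, and $G$ is tight if it has exactly $m(G)$ dense vertices and each of them has degree exactly $m(G)-1$. For a vertex set $X$, the outer boundary $\delta X$ is the set of vertices outside $X$ that have a neighbour in $X$. Colourings are proper and take values in $\mathbb{Z}^+$; a colouring $c$ is a b-colouring if every colour class contains a vertex that has a neighbour in every other colour class. Let $G$ be a tight graph with set $T$ of dense vertices and let $S'\subseteq\delta T$. An $S'$-partial b-colouring is a colouring $c'$ of $G[S'\cup T]$ such that (1) $c'(u)\ne c'(u')$ for distinct $u,u'\in T$, and (2) whenever $u\in T$ and $c'(u)=c'(s)$ for some $s\in S'$, every vertex of $T\setminus\{u\}$ has exactly one neighbour in $S'\cup T$ with colour $c'(u)$. A b-precolouring extension of $c'$ is a b-colouring $c$ of $G$ that agrees with $c'$ on $S'\cup T$ and such that every colour class of $c$ with at least two vertices of $\delta T$ contains no vertex of $\delta T\setminus S'$. Theorem. There is a polynomial-time algorithm that, given a tight graph $G$, a set $S'\subseteq\delta T$ and an $S'$-partial b-colouring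 $c'$ of $G$, decides whether $c'$ has a b-precolouring extension in $G$. Moreover, let $T_1$ be the set of $u\in T$ that are adjacent to all of $T\setminus\{u\}$, let $T'$ be the set of $u\in T$ that have the same colour as some vertex of $S'$, let $T_2=T\setminus(T_1\cup T')$, and let $G^*$ be the bipartite graph with partition classes $T_2$ and $\delta T\setminus S'$ in which $u\in T_2$ and $s\in\delta T\setminus S'$ are adjacent if and only if $us\notin E(G)$ and $u,s$ have no common neighbour in $(T_2\cup T')\setminus\{u\}$ in $G$. Then $c'$ has a b-precolouring extension in $G$ if and only if every colour that $c'$ uses on $S'$ is also used on $T$ and $G^*$ has a perfect matching. -/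

import Mathlib

/-! ### b-colourings of finite simple graphs -/

namespace BCol

universe u

variable {V : Type u}

/-- The degree of a vertex of a (finite) graph: the number of its neighbours. -/
noncomputable def deg (G : SimpleGraph V) (v : V) : ℕ := (G.neighborSet v).ncard

/-- The `m`-degree: the largest `k` such that at least `k` vertices have degree at least `k - 1`
(for finite `V` the set below contains `0` and is bounded by the number of vertices). -/
noncomputable def mDegree (G : SimpleGraph V) : ℕ :=
  sSup {k : ℕ | k ≤ {v : V | k ≤ deg G v + 1}.ncard}

/-- The set of dense vertices, i.e. of those of degree at least `m(G) - 1`. -/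
def denseSet (G : SimpleGraph V) : Set V := {v | mDegree G ≤ deg G v + 1}

/-- `G` is tight: it has exactly `m(G)` dense vertices, each of degree exactly `m(G) - 1`. -/
def IsTight (G : SimpleGraph V) : Prop :=
  (denseSet G).ncard = mDegree G ∧ ∀ v ∈ denseSet G, deg G v + 1 = mDegree G

/-- The outer boundary of a set `S` of vertices: the vertices outside `S` with a neighbour
in `S`. -/
def outerBoundary (G : SimpleGraph V) (S : Set V) : Set V :=
  (⋃ u ∈ S, G.neighborSet u) \ S

/-- `v` is b-chromatic under `c`: it has a neighbour in every colour class of `c` but its own. -/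
def IsBChromatic {G : SimpleGraph V} (c : G.Coloring ℕ+) (v : V) : Prop :=
  ∀ j ∈ Set.range c, j ≠ c v → ∃ w, G.Adj v w ∧ c w = j

/-- A b-colouring: every (nonempty) colour class contains a b-chromatic vertex. -/
def IsBColouring {G : SimpleGraph V} (c : G.Coloring ℕ+) : Prop :=
  ∀ i ∈ Set.range c, ∃ v, c v = i ∧ IsBChromatic c v

/-- Colourings of `G[S' ∪ T]`, where `T` is the set of dense vertices of `G`. -/
abbrev PreColouring (G : SimpleGraph V) (S' : Set V) : Type u :=
  (G.induce (S' ∪ denseSet G)).Coloring ℕ+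

/-- The colouring `c'` of `G[S' ∪ T]` is an `S'`-partial b-colouring. -/
structure IsPartialBColouring (G : SimpleGraph V) (S' : Set V) (c' : PreColouring G S') :
    Prop where
  /-- Distinct dense vertices have distinct colours. -/
  injective_on_dense : ∀ u u' : ↥(S' ∪ denseSet G),
    (u : V) ∈ denseSet G → (u' : V) ∈ denseSet G → u ≠ u' → c' u ≠ c' u'
  /-- If a dense vertex `u` shares its colour with a vertex of `S'`, then every other dense vertex
  has exactly one neighbour with that colour. -/
  unique_neighbour : ∀ u : ↥(S' ∪ denseSet G), (u : V) ∈ denseSet G →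
    (∃ s : ↥(S' ∪ denseSet G), (s : V) ∈ S' ∧ c' u = c' s) →
    ∀ w ∈ denseSet G, w ≠ (u : V) →
      ∃! x : ↥(S' ∪ denseSet G), G.Adj w (x : V) ∧ c' x = c' u

/-- The colouring `c` of `G` is a b-precolouring extension of `c'`. -/
structure IsBPrecolouringExtension (G : SimpleGraph V) (S' : Set V) (c' : PreColouring G S')
    (c : G.Coloring ℕ+) : Prop where
  isBColouring : IsBColouring c
  extends_pre : ∀ v : ↥(S' ∪ denseSet G), c (v : V) = c' v
  /-- A colour class with at least two vertices of `δT` contains no vertex of `δT \ S'`. -/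
  boundary_class : ∀ i : ℕ+,
    2 ≤ (c.colorClass i ∩ outerBoundary G (denseSet G)).ncard →
    Disjoint (c.colorClass i) (outerBoundary G (denseSet G) \ S')

/-- `c'` has a b-precolouring extension in `G`. -/
def HasBPrecolouringExtension (G : SimpleGraph V) (S' : Set V) (c' : PreColouring G S') : Prop :=
  ∃ c : G.Coloring ℕ+, IsBPrecolouringExtension G S' c' c

/-! ### The auxiliary bipartite graph -/

/-- `T₁`: the dense vertices that are dominating vertices of `G[T]`. -/
def T₁ (G : SimpleGraph V) : Set V :=
  {u | u ∈ denseSet G ∧ ∀ w ∈ denseSet G, w ≠ u → G.Adj w u}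

/-- `T'`: the dense vertices that have the same colour as some vertex of `S'`. -/
def T' (G : SimpleGraph V) (S' : Set V) (c' : PreColouring G S') : Set V :=
  {v | ∃ u s : ↥(S' ∪ denseSet G),
    (u : V) = v ∧ v ∈ denseSet G ∧ (s : V) ∈ S' ∧ c' u = c' s}

/-- `T₂ = T \ (T₁ ∪ T')`. -/
def T₂ (G : SimpleGraph V) (S' : Set V) (c' : PreColouring G S') : Set V :=
  denseSet G \ (T₁ G ∪ T' G S' c')

/-- The auxiliary bipartite graph with partition classes `T₂` and `δT \ S'`: here `u ∈ T₂` is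
joined to `s ∈ δT \ S'` iff they are not adjacent in `G` and have no common neighbour
in `(T₂ ∪ T') \ {u}`. -/
def auxGraph (G : SimpleGraph V) (S' : Set V) (c' : PreColouring G S') :
    SimpleGraph (↥(T₂ G S' c') ⊕ ↥(outerBoundary G (denseSet G) \ S')) :=
  SimpleGraph.fromRel fun x y =>
    ∃ (u : ↥(T₂ G S' c')) (s : ↥(outerBoundary G (denseSet G) \ S')),
      x = Sum.inl u ∧ y = Sum.inr s ∧ ¬ G.Adj (u : V) (s : V) ∧
      ∀ w ∈ (T₂ G S' c' ∪ T' G S' c') \ {(u : V)},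
        ¬ (G.Adj (u : V) w ∧ G.Adj (s : V) w)

end BCol

/-! ### Polynomial time on random access machines

Structured programs for a random access machine with registers and arrays of natural numbers.
The arithmetic operations are addition and truncated subtraction (no multiplication), and every
elementary instruction and every test costs one step. As no multiplication is available, a number
grows by at most one bit per step, so polynomial time in this model coincides with polynomial time
on Turing machines. -/

namespace RAM

/-- Programs. Registers and arrays are named by natural numbers fixed in the program text. -/
inductive Prog : Type
  /-- do nothing -/
  | skip : Prog
  /-- `x := k` for a constant `k` -/
  | const (x k : ℕ) : Prog
  /-- `x := y` -/
  | copy (x y : ℕ) : Prog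
  /-- `x := y + z` -/
  | add (x y z : ℕ) : Prog
  /-- `x := max (y - z) 0` -/
  | sub (x y z : ℕ) : Prog
  /-- `x := a[i]`, where the index is the content of register `i` -/
  | load (x a i : ℕ) : Prog
  /-- `a[i] := x`, where the index is the content of register `i` -/
  | store (a i x : ℕ) : Prog
  /-- first `p`, then `q` -/
  | seq (p q : Prog) : Prog
  /-- if `x ≠ 0` then `p` else `q` -/
  | branch (x : ℕ) (p q : Prog) : Prog
  /-- while `x ≠ 0` do `p` -/
  | loop (x : ℕ) (p : Prog) : Prog

/-- Memory states: the contents of the registers and of the cells of the arrays. -/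
@[ext]
structure State : Type where
  reg : ℕ → ℕ
  arr : ℕ → ℕ → ℕ

/-- Write `n` into register `x`. -/
def State.setReg (s : State) (x n : ℕ) : State :=
  { s with reg := Function.update s.reg x n }

/-- Write `n` into cell `i` of array `a`. -/
def State.setArr (s : State) (a i n : ℕ) : State :=
  { s with arr := Function.update s.arr a (Function.update (s.arr a) i n) }

/-- `Exec p s t s'`: started in the state `s`, the program `p` terminates after exactly `t` steps
in the state `s'`. -/
inductive Exec : Prog → State → ℕ → State → Prop
  | skip (s : State) : Exec Prog.skip s 1 s
  | const (s : State) (x k : ℕ) : Exec (Prog.const x k) s 1 (s.setReg x k)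
  | copy (s : State) (x y : ℕ) : Exec (Prog.copy x y) s 1 (s.setReg x (s.reg y))
  | add (s : State) (x y z : ℕ) : Exec (Prog.add x y z) s 1 (s.setReg x (s.reg y + s.reg z))
  | sub (s : State) (x y z : ℕ) : Exec (Prog.sub x y z) s 1 (s.setReg x (s.reg y - s.reg z))
  | load (s : State) (x a i : ℕ) : Exec (Prog.load x a i) s 1 (s.setReg x (s.arr a (s.reg i)))
  | store (s : State) (a i x : ℕ) :
      Exec (Prog.store a i x) s 1 (s.setArr a (s.reg i) (s.reg x))
  | seq {p q : Prog} {s s' s'' : State} {t t' : ℕ} (hp : Exec p s t s') (hq : Exec q s' t' s'') :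
      Exec (Prog.seq p q) s (t + t') s''
  | branch_pos {x : ℕ} {p q : Prog} {s s' : State} {t : ℕ} (hx : s.reg x ≠ 0)
      (hp : Exec p s t s') : Exec (Prog.branch x p q) s (t + 1) s'
  | branch_zero {x : ℕ} {p q : Prog} {s s' : State} {t : ℕ} (hx : s.reg x = 0)
      (hq : Exec q s t s') : Exec (Prog.branch x p q) s (t + 1) s'
  | loop_pos {x : ℕ} {p : Prog} {s s' s'' : State} {t t' : ℕ} (hx : s.reg x ≠ 0)
      (hp : Exec p s t s') (hl : Exec (Prog.loop x p) s' t' s'') :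
      Exec (Prog.loop x p) s (t + t' + 1) s''
  | loop_zero {x : ℕ} {p : Prog} {s : State} (hx : s.reg x = 0) : Exec (Prog.loop x p) s 1 s

/-- The initial state on the input `l`: register `0` holds the length of `l`, array `0` holds the
entries of `l`, and everything else is `0`. -/
def initState (l : List ℕ) : State where
  reg := fun x => if x = 0 then l.length else 0
  arr := fun a i => if a = 0 then l.getD i 0 else 0

/-- The size of an input: the total length of its entries written in binary, each one followed by
a separator. -/
def inputSize (l : List ℕ) : ℕ := (l.map fun a => Nat.size a + 1).sum

/-- The property `P` of instances, presented to the machine through the encoding `enc`, is decidable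
in polynomial time: one program halts on every instance within a number of steps that is bounded by
a fixed polynomial in the input size, leaving `1` in register `0` if `P` holds
and `0` if it does not. -/
def DecidableInPolyTime {α : Type*} (enc : α → List ℕ) (P : α → Prop) : Prop :=
  ∃ (prog : Prog) (b : Polynomial ℕ), ∀ a : α, ∃ (t : ℕ) (s : State),
    Exec prog (initState (enc a)) t s ∧ t ≤ b.eval (inputSize (enc a)) ∧
    (P a → s.reg 0 = 1) ∧ (¬ P a → s.reg 0 = 0)

end RAM

namespace BCol

/-- An instance of the decision problem: a tight graph on the vertices `0, …, n - 1`, a subset `S'`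
of the outer boundary of its set of dense vertices, and an `S'`-partial b-colouring. -/
structure Instance : Type where
  n : ℕ
  G : SimpleGraph (Fin n)
  S' : Set (Fin n)
  c' : PreColouring G S'
  isTight : IsTight G
  subset_boundary : S' ⊆ outerBoundary G (denseSet G)
  isPartial : IsPartialBColouring G S' c'

open Classical in
/-- The input that describes an instance: the number of vertices, the adjacency matrix row by row,
the indicator vector of `S'`, and the vector of the colours of the vertices under `c'`,
with entry `0` for the uncoloured vertices. -/
noncomputable def Instance.encode (I : Instance) : List ℕ :=
  [I.n]
  ++ (List.finRange I.n).flatMap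
      (fun i => (List.finRange I.n).map fun j => if I.G.Adj i j then 1 else 0)
  ++ (List.finRange I.n).map (fun v => if v ∈ I.S' then 1 else 0)
  ++ (List.finRange I.n).map
      (fun v => if h : v ∈ I.S' ∪ denseSet I.G then (I.c' ⟨v, h⟩ : ℕ) else 0)

/-- The question asked about an instance. -/
def Instance.HasExtension (I : Instance) : Prop :=
  HasBPrecolouringExtension I.G I.S' I.c'

end BCol

/-!
Each of the `m` dense vertices of a tight graph has degree `m - 1`, so in a b-colouring whose
colours on the dense set `T` are distinct, these are all the colours, and no colour repeats on the
neighbourhood of a dense vertex. Conversely, distinct colours on `T` and on each neighbourhood of a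
dense vertex make a colouring with the colours of `T` a b-colouring.

The colour of a vertex `u` of `T'` is already present around all other dense vertices, and that of a
vertex of `T₁` can occur nowhere else near `T`. For `u ∈ T₂` some dense vertex is not adjacent to
`u`, hence sees its colour on the uncoloured boundary `δT \ S'`. As a colour that is repeated on
`δT` does not occur on `δT \ S'`, this happens at a single vertex `s`, which is neither adjacent to
`u` nor joined to it by a dense vertex of degree `m - 1`. Every vertex of `δT \ S'` arises in this
way, so the pairs `us` form a perfect matching of `G*`. Given such a matching, colour every `s` like
its partner; the vertices outside `T ∪ δT` have degree less than `m - 1` and are coloured greedily.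

A perfect matching is found by an auction: as long as some `u ∈ T₂` owns no item of `δT \ S'`, it
takes a cheapest acceptable one, whose price goes up by one. If a perfect matching exists, all
prices stay at most the number of items, which bounds the number of rounds. The auction is written
in a language of bounded loops, and these compile to the random access machine with polynomial
overhead.
-/

namespace BCol

/-! ### Perfect matchings of relations and of bipartite graphs -/

section Matching

variable {α β : Type*}

/-- The relation `E`, viewed as a bipartite graph with classes `α` and `β`, has a perfect
matching. -/
def PerfectlyMatchable (E : α → β → Prop) : Prop := ∃ e : α ≃ β, ∀ a, E a (e a)

theorem PerfectlyMatchable.mono {R E : α → β → Prop} (hR : PerfectlyMatchable R)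
    (h : ∀ a b, R a b → E a b) : PerfectlyMatchable E :=
  hR.imp fun e he a => h a (e a) (he a)

theorem PerfectlyMatchable.of_existsUnique {R : α → β → Prop} (hα : ∀ a, ∃! b, R a b)
    (hβ : ∀ b, ∃! a, R a b) : PerfectlyMatchable R := by
  choose f hf eq_f using hα
  have bijective : f.Bijective := by
    refine ⟨fun a a' h => (hβ (f a)).unique (hf a) (h ▸ hf a'), fun b => ?_⟩
    obtain ⟨a, ha, -⟩ := hβ b
    exact ⟨a, (eq_f a b ha).symm⟩
  exact ⟨Equiv.ofBijective f bijective, hf⟩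

variable {H : SimpleGraph (α ⊕ β)}

theorem exists_isPerfectMatching_iff (hH : H ≤ completeBipartiteGraph α β) :
    (∃ M : H.Subgraph, M.IsPerfectMatching) ↔
      PerfectlyMatchable fun a b => H.Adj (Sum.inl a) (Sum.inr b) := by
  constructor
  · rintro ⟨M, hM⟩
    rw [SimpleGraph.Subgraph.isPerfectMatching_iff] at hM
    refine (PerfectlyMatchable.of_existsUnique (R := fun a b => M.Adj (Sum.inl a) (Sum.inr b))
      (fun a => ?_) fun b => ?_).mono fun a b h => h.adj_sub
    · obtain ⟨a' | b, hb, unique⟩ := hM (Sum.inl a)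
      · simpa using hH hb.adj_sub
      · exact ⟨b, hb, fun b' hb' => Sum.inr_injective (unique _ hb')⟩
    · obtain ⟨a | b', ha, unique⟩ := hM (Sum.inr b)
      · exact ⟨a, ha.symm, fun a' ha' => Sum.inl_injective (unique _ ha'.symm)⟩
      · simpa using hH ha.adj_sub
  · rintro ⟨e, he⟩
    let M : H.Subgraph :=
      { verts := Set.univ
        Adj := fun x y => ∃ a, s(x, y) = s(Sum.inl a, Sum.inr (e a))
        adj_sub := by
          rintro x y ⟨a, h⟩
          exact (SimpleGraph.mem_edgeSet H).1 (h ▸ he a)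
        edge_vert := fun _ => Set.mem_univ _
        symm := ⟨fun x y ⟨a, h⟩ => ⟨a, Sym2.eq_swap.trans h⟩⟩ }
    refine ⟨M, SimpleGraph.Subgraph.isPerfectMatching_iff.2 ?_⟩
    rintro (a | b)
    · exact ⟨Sum.inr (e a), ⟨a, rfl⟩, by rintro y ⟨a', h⟩; aesop⟩
    · exact ⟨Sum.inl (e.symm b), ⟨e.symm b, by simp [Sym2.eq_swap]⟩,
        by rintro y ⟨a', h⟩; aesop⟩

end Matching

universe u

variable {V : Type u} {G : SimpleGraph V}

/-! ### Tight graphs -/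

theorem mem_outerBoundary_iff {X : Set V} {s : V} :
    s ∈ outerBoundary G X ↔ (∃ w ∈ X, G.Adj w s) ∧ s ∉ X := by
  simp [outerBoundary]

theorem neighborSet_subset_union_outerBoundary {X : Set V} {w : V} (hw : w ∈ X) :
    G.neighborSet w ⊆ X ∪ outerBoundary G X := fun x hx => by
  by_cases h : x ∈ X
  · exact Or.inl h
  · exact Or.inr (mem_outerBoundary_iff.2 ⟨⟨w, hw, hx⟩, h⟩)

variable {c : G.Coloring ℕ+}

theorem image_neighborSet_subset (v : V) : c '' G.neighborSet v ⊆ Set.range c \ {c v} := by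
  rintro _ ⟨w, hw, rfl⟩
  exact ⟨⟨w, rfl⟩, (c.valid hw).symm⟩

theorem isBChromatic_iff_subset_image {v : V} :
    IsBChromatic c v ↔ Set.range c \ {c v} ⊆ c '' G.neighborSet v :=
  ⟨fun h j hj => h j hj.1 hj.2, fun h _ hj hjv => h ⟨hj, hjv⟩⟩

section Finite

variable [Finite V]

theorem le_mDegree {k : ℕ} (hk : k ≤ {v : V | k ≤ deg G v + 1}.ncard) : k ≤ mDegree G :=
  le_csSup ⟨Nat.card V, fun _ hj => hj.trans (Set.ncard_le_card _)⟩ hk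

theorem IsTight.neighborSet_of_mem_T₁ (hG : IsTight G) {w : V} (hw : w ∈ T₁ G) :
    G.neighborSet w = denseSet G \ {w} := by
  refine (Set.eq_of_subset_of_ncard_le ?_ ?_).symm
  · rintro x ⟨hx, hxw⟩
    exact (hw.2 x hx hxw).symm
  · have hdeg : (G.neighborSet w).ncard + 1 = mDegree G := hG.2 w hw.1
    rw [Set.ncard_sdiff_singleton_of_mem hw.1, hG.1]
    omega

theorem IsBChromatic.ncard_range_le {v : V} (h : IsBChromatic c v) :
    (Set.range c).ncard ≤ deg G v + 1 := by
  have hcard := (Set.ncard_le_ncard (isBChromatic_iff_subset_image.1 h)).trans Set.ncard_image_le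
  rw [Set.ncard_sdiff_singleton_of_mem (Set.mem_range_self v)] at hcard
  change _ ≤ deg G v at hcard
  omega

theorem isBChromatic_iff_injOn {v : V} (hv : (Set.range c).ncard = deg G v + 1) :
    IsBChromatic c v ↔ Set.InjOn c (G.neighborSet v) := by
  have hcard : (Set.range c \ {c v}).ncard = (G.neighborSet v).ncard := by
    rw [Set.ncard_sdiff_singleton_of_mem (Set.mem_range_self v), hv]
    rfl
  rw [isBChromatic_iff_subset_image, ← Set.ncard_image_iff (Set.toFinite _), ← hcard]
  exact ⟨fun h => congrArg Set.ncard ((image_neighborSet_subset v).antisymm h),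
    fun h => (Set.eq_of_subset_of_ncard_le (image_neighborSet_subset v) h.ge).ge⟩

theorem IsBColouring.ncard_range_le_mDegree (hc : IsBColouring c) :
    (Set.range c).ncard ≤ mDegree G := by
  have hrange : Set.range c ⊆ c '' {v | (Set.range c).ncard ≤ deg G v + 1} := fun i hi => by
    obtain ⟨v, hv, hvb⟩ := hc i hi
    exact ⟨v, hvb.ncard_range_le, hv⟩
  exact le_mDegree ((Set.ncard_le_ncard hrange).trans (Set.ncard_image_le))

theorem IsTight.isBColouring_iff (hG : IsTight G) (hinj : Set.InjOn c (denseSet G)) :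
    IsBColouring c ↔ Set.range c ⊆ c '' denseSet G ∧
      ∀ w ∈ denseSet G, Set.InjOn c (G.neighborSet w) := by
  have hcard : (c '' denseSet G).ncard = mDegree G := by rw [hinj.ncard_image, hG.1]
  constructor
  · intro hc
    have himage : c '' denseSet G = Set.range c :=
      Set.eq_of_subset_of_ncard_le (Set.image_subset_range _ _)
        (hcard ▸ hc.ncard_range_le_mDegree)
    rw [himage] at hcard ⊢
    refine ⟨subset_rfl, fun w hw => (isBChromatic_iff_injOn (hcard.trans (hG.2 w hw).symm)).1 ?_⟩
    obtain ⟨v, hvw, hv⟩ := hc (c w) ⟨w, rfl⟩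
    rwa [← hinj (hcard.symm.trans_le hv.ncard_range_le) hw hvw]
  · rintro ⟨hrange, hnbr⟩ i hi
    obtain ⟨w, hw, rfl⟩ := hrange hi
    refine ⟨w, rfl, (isBChromatic_iff_injOn ?_).2 (hnbr w hw)⟩
    rw [hrange.antisymm (Set.image_subset_range _ _), hcard, hG.2 w hw]

theorem exists_coloring_insert {γ : Type*} {C : Set γ} {W : Set V} {c₀ : V → γ} {x : V}
    (hx : x ∉ W)
    (hmaps : Set.MapsTo c₀ W C) (hproper : ∀ v ∈ W, ∀ w ∈ W, G.Adj v w → c₀ v ≠ c₀ w)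
    (hdeg : deg G x < C.ncard) :
    ∃ c₁ : V → γ, Set.EqOn c₁ c₀ W ∧ Set.MapsTo c₁ (insert x W) C ∧
      ∀ v ∈ insert x W, ∀ w ∈ insert x W, G.Adj v w → c₁ v ≠ c₁ w := by
  classical
  obtain ⟨i, hiC, hi⟩ : ∃ i ∈ C, i ∉ c₀ '' G.neighborSet x :=
    Set.exists_mem_notMem_of_ncard_lt_ncard (lt_of_le_of_lt Set.ncard_image_le hdeg)
  have heq : Set.EqOn (Function.update c₀ x i) c₀ W := fun v hv =>
    Function.update_of_ne (fun h : v = x => hx (h ▸ hv)) _ _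
  refine ⟨Function.update c₀ x i, heq, ?_, ?_⟩
  · rintro v (rfl | hv)
    · rwa [Function.update_self]
    · rw [heq hv]
      exact hmaps hv
  · rintro v (rfl | hv) w (rfl | hw) hvw
    · exact absurd hvw (G.loopless.irrefl _)
    · rw [Function.update_self, heq hw]
      exact fun h => hi ⟨w, hvw, h.symm⟩
    · rw [Function.update_self, heq hv]
      exact fun h => hi ⟨v, hvw.symm, h⟩
    · rw [heq hv, heq hw]
      exact hproper v hv w hw hvw

theorem exists_greedy_extension {γ : Type*} {C : Set γ} {W : Set V} {c₀ : V → γ}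
    (hmaps : Set.MapsTo c₀ W C) (hproper : ∀ v ∈ W, ∀ w ∈ W, G.Adj v w → c₀ v ≠ c₀ w)
    (hdeg : ∀ v, v ∉ W → deg G v < C.ncard) :
    ∃ c : G.Coloring γ, Set.range c ⊆ C ∧ Set.EqOn c c₀ W := by
  induction W using WellFoundedGT.induction generalizing c₀ with
  | ind W ih =>
    by_cases hW : W = Set.univ
    · subst hW
      exact ⟨SimpleGraph.Coloring.mk c₀ fun {v w} => hproper v trivial w trivial,
        Set.range_subset_iff.2 fun v => hmaps (Set.mem_univ v), Set.eqOn_refl _ _⟩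
    · obtain ⟨x, hx⟩ := (Set.ne_univ_iff_exists_notMem W).1 hW
      obtain ⟨c₁, heq, hmaps₁, hproper₁⟩ := exists_coloring_insert hx hmaps hproper (hdeg x hx)
      obtain ⟨c, hc, hcc₁⟩ := ih _ (Set.ssubset_insert hx) hmaps₁ hproper₁
        fun v hv => hdeg v fun h => hv (Set.mem_insert_of_mem x h)
      exact ⟨c, hc, (hcc₁.mono (Set.subset_insert x W)).trans heq⟩

end Finite

/-! ### Colourings that extend a precolouring -/

/-- The part of the boundary of the dense set that is left uncoloured by an `S'`-partial
b-colouring; the second partition class of `auxGraph`. -/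
abbrev freeBoundary (G : SimpleGraph V) (S' : Set V) : Set V := outerBoundary G (denseSet G) \ S'

variable {S' : Set V} {c' : PreColouring G S'}

/-- The adjacency relation of `auxGraph`, between arbitrary vertices of `G`. -/
def AuxAdj (G : SimpleGraph V) (S' : Set V) (c' : PreColouring G S') (u s : V) : Prop :=
  ¬ G.Adj u s ∧ ∀ w ∈ (T₂ G S' c' ∪ T' G S' c') \ {u}, ¬ (G.Adj u w ∧ G.Adj s w)

theorem auxGraph_adj_inl_inr {u : T₂ G S' c'} {s : freeBoundary G S'} :
    (auxGraph G S' c').Adj (Sum.inl u) (Sum.inr s) ↔ AuxAdj G S' c' u s := by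
  constructor
  · rintro ⟨-, ⟨u, s, hu, hs, h⟩ | ⟨u, s, h, -, -⟩⟩
    · cases hu
      cases hs
      exact h
    · cases h
  · exact fun h => ⟨Sum.inl_ne_inr, Or.inl ⟨u, s, rfl, rfl, h⟩⟩

theorem auxGraph_le_completeBipartiteGraph :
    auxGraph G S' c' ≤ completeBipartiteGraph (T₂ G S' c') (freeBoundary G S') := by
  rintro x y ⟨-, ⟨u, s, rfl, rfl, -⟩ | ⟨u, s, rfl, rfl, -⟩⟩ <;> simp

theorem exists_isPerfectMatching_auxGraph_iff :
    (∃ M : (auxGraph G S' c').Subgraph, M.IsPerfectMatching) ↔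
      PerfectlyMatchable fun (u : T₂ G S' c') (s : freeBoundary G S') => AuxAdj G S' c' u s := by
  simp only [exists_isPerfectMatching_iff auxGraph_le_completeBipartiteGraph,
    auxGraph_adj_inl_inr]

/-- The colour function `c₀` on `V` agrees with the precolouring `c'`. -/
def Extends (c' : PreColouring G S') (c₀ : V → ℕ+) : Prop :=
  ∀ v : ↥(S' ∪ denseSet G), c₀ v = c' v

/-- Every colour of the precolouring on `S'` is also used on the dense vertices. -/
def ColoursUsedOnDense (c' : PreColouring G S') : Prop :=
  ∀ s : ↥(S' ∪ denseSet G), (s : V) ∈ S' →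
    ∃ u : ↥(S' ∪ denseSet G), (u : V) ∈ denseSet G ∧ c' u = c' s

theorem mem_denseSet_of_mem_T₂_union_T' {w : V} (hw : w ∈ T₂ G S' c' ∪ T' G S' c') :
    w ∈ denseSet G := by
  rcases hw with hw | ⟨-, -, -, hw, -⟩
  exacts [hw.1, hw]

theorem mem_T₁_of_notMem {w : V} (hw : w ∈ denseSet G) (h : w ∉ T₂ G S' c' ∪ T' G S' c') :
    w ∈ T₁ G := by
  by_contra hT₁
  exact h (Or.inl ⟨hw, fun h' => h'.elim hT₁ fun hT' => h (Or.inr hT')⟩)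

namespace Extends

variable {c₀ : V → ℕ+} (h : Extends c' c₀)

include h

theorem eq_iff (u v : ↥(S' ∪ denseSet G)) : c' u = c' v ↔ c₀ u = c₀ v := by
  rw [h u, h v]

theorem injOn_denseSet (hp : IsPartialBColouring G S' c') : Set.InjOn c₀ (denseSet G) := by
  intro u hu u' hu' heq
  by_contra hne
  exact hp.injective_on_dense ⟨u, Or.inr hu⟩ ⟨u', Or.inr hu'⟩ hu hu'
    (fun h' => hne (congrArg Subtype.val h')) ((h.eq_iff _ _).2 heq)

theorem mem_T'_iff {u : V} : u ∈ T' G S' c' ↔ u ∈ denseSet G ∧ ∃ s ∈ S', c₀ u = c₀ s := by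
  constructor
  · rintro ⟨u, s, rfl, hu, hs, hus⟩
    exact ⟨hu, s, hs, (h.eq_iff _ _).1 hus⟩
  · rintro ⟨hu, s, hs, hus⟩
    exact ⟨⟨u, Or.inr hu⟩, ⟨s, Or.inl hs⟩, rfl, hu, hs, (h.eq_iff _ _).2 hus⟩

theorem coloursUsedOnDense_iff :
    ColoursUsedOnDense c' ↔ ∀ s ∈ S', ∃ u ∈ denseSet G, c₀ u = c₀ s := by
  constructor
  · intro hcol s hs
    obtain ⟨u, hu, hus⟩ := hcol ⟨s, Or.inl hs⟩ hs
    exact ⟨u, hu, (h.eq_iff _ _).1 hus⟩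
  · intro hcol s hs
    obtain ⟨u, hu, hus⟩ := hcol s hs
    exact ⟨⟨u, Or.inr hu⟩, hu, (h.eq_iff _ _).2 hus⟩

theorem eq_of_mem_T' (hp : IsPartialBColouring G S' c') {u w x y : V} (hu : u ∈ T' G S' c')
    (hw : w ∈ denseSet G) (hwu : w ≠ u) (hx : x ∈ S' ∪ denseSet G) (hy : y ∈ S' ∪ denseSet G)
    (hwx : G.Adj w x) (hwy : G.Adj w y) (hxu : c₀ x = c₀ u) (hyu : c₀ y = c₀ u) : x = y := by
  obtain ⟨u, s, rfl, hu, hs, hus⟩ := hu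
  exact congrArg Subtype.val <| (hp.unique_neighbour u hu ⟨s, hs, hus⟩ w hw hwu).unique
    (y₁ := ⟨x, hx⟩) (y₂ := ⟨y, hy⟩) ⟨hwx, (h.eq_iff _ _).2 hxu⟩ ⟨hwy, (h.eq_iff _ _).2 hyu⟩

end Extends

/-! ### Necessity: the colour classes of an extension form a perfect matching -/

section Necessity

variable {c : G.Coloring ℕ+} {u s : V}

theorem IsBPrecolouringExtension.eq_of_mem_freeBoundary (hc : IsBPrecolouringExtension G S' c' c)
    [Finite V] {s' : V} (hs : s ∈ freeBoundary G S') (hs' : s' ∈ outerBoundary G (denseSet G))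
    (hss' : c s = c s') : s = s' := by
  by_contra hne
  have hpair : {s, s'} ⊆ c.colorClass (c s) ∩ outerBoundary G (denseSet G) := by
    rintro x (rfl | rfl)
    exacts [⟨rfl, hs.1⟩, ⟨hss'.symm, hs'⟩]
  refine Set.disjoint_left.1 (hc.boundary_class (c s) ?_) rfl hs
  exact (Set.ncard_pair hne).ge.trans (Set.ncard_le_ncard hpair)

theorem auxAdj_of_color_eq (hnbr : ∀ w ∈ denseSet G, Set.InjOn c (G.neighborSet w))
    (hu : u ∈ denseSet G) (hs : s ∈ freeBoundary G S') (hus : c u = c s) :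
    AuxAdj G S' c' u s := by
  refine ⟨fun hadj => c.valid hadj hus, ?_⟩
  rintro w ⟨hw, -⟩ ⟨huw, hsw⟩
  have : u = s := hnbr w (mem_denseSet_of_mem_T₂_union_T' hw) huw.symm hsw.symm hus
  exact hs.1.2 (this ▸ hu)

theorem exists_mem_freeBoundary_of_mem_T₂ (hc : Extends c' c) (hp : IsPartialBColouring G S' c')
    (hb : ∀ w ∈ denseSet G, IsBChromatic c w) (hu : u ∈ T₂ G S' c') :
    ∃ s ∈ freeBoundary G S', c u = c s := by
  obtain ⟨w, hw, hwu, hnadj⟩ : ∃ w ∈ denseSet G, w ≠ u ∧ ¬ G.Adj w u := by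
    by_contra! hadj
    exact hu.2 (Or.inl ⟨hu.1, hadj⟩)
  have hinj := hc.injOn_denseSet hp
  obtain ⟨x, hx, hxu⟩ := hb w hw (c u) ⟨u, rfl⟩ fun huw => hwu (hinj hw hu.1 huw.symm)
  have hxT : x ∉ denseSet G := fun h => hnadj (hinj h hu.1 hxu ▸ hx)
  exact ⟨x, ⟨mem_outerBoundary_iff.2 ⟨⟨w, hw, hx⟩, hxT⟩,
    fun hxS => hu.2 (Or.inr (hc.mem_T'_iff.2 ⟨hu.1, x, hxS, hxu.symm⟩))⟩, hxu.symm⟩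

theorem IsBPrecolouringExtension.mem_T₂_of_color_eq [Finite V]
    (hc : IsBPrecolouringExtension G S' c' c) (hS : S' ⊆ outerBoundary G (denseSet G))
    (hnbr : ∀ w ∈ denseSet G, Set.InjOn c (G.neighborSet w))
    (hu : u ∈ denseSet G) (hs : s ∈ freeBoundary G S') (hus : c u = c s) :
    u ∈ T₂ G S' c' := by
  refine ⟨hu, ?_⟩
  rintro (hT₁ | hT')
  · obtain ⟨⟨w, hw, hws⟩, hsT⟩ := mem_outerBoundary_iff.1 hs.1
    have hwu : w ≠ u := by
      rintro rfl
      exact c.valid hws hus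
    have : u = s := hnbr w hw (hT₁.2 w hw hwu) hws hus
    exact hsT (this ▸ hu)
  · obtain ⟨-, s', hs', hus'⟩ := (Extends.mem_T'_iff hc.extends_pre).1 hT'
    have : s = s' := hc.eq_of_mem_freeBoundary hs (hS hs') (hus.symm.trans hus')
    exact hs.2 (this ▸ hs')

theorem IsBPrecolouringExtension.coloursUsedOnDense_and_perfectlyMatchable [Finite V]
    (hG : IsTight G) (hS : S' ⊆ outerBoundary G (denseSet G))
    (hp : IsPartialBColouring G S' c') (hc : IsBPrecolouringExtension G S' c' c) :
    ColoursUsedOnDense c' ∧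
      PerfectlyMatchable fun (u : T₂ G S' c') (s : freeBoundary G S') => AuxAdj G S' c' u s := by
  have hext : Extends c' c := hc.extends_pre
  have hinj := hext.injOn_denseSet hp
  obtain ⟨hrange, hnbr⟩ := (hG.isBColouring_iff hinj).1 hc.isBColouring
  have hb : ∀ w ∈ denseSet G, IsBChromatic c w := fun w hw =>
    (isBChromatic_iff_injOn (by
      rw [hrange.antisymm (Set.image_subset_range _ _), hinj.ncard_image, hG.1, hG.2 w hw])).2
      (hnbr w hw)
  refine ⟨hext.coloursUsedOnDense_iff.2 fun s _ => hrange ⟨s, rfl⟩, ?_⟩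
  refine (PerfectlyMatchable.of_existsUnique
    (R := fun (u : T₂ G S' c') (s : freeBoundary G S') => c u = c s) (fun u => ?_)
    fun s => ?_).mono fun u s hus => auxAdj_of_color_eq hnbr u.2.1 s.2 hus
  · obtain ⟨s, hs, hus⟩ := exists_mem_freeBoundary_of_mem_T₂ hext hp hb u.2
    exact ⟨⟨s, hs⟩, hus, fun s' hus' =>
      Subtype.ext (hc.eq_of_mem_freeBoundary s'.2 hs.1 (hus'.symm.trans hus))⟩
  · obtain ⟨u, hu, hus⟩ := hrange ⟨s, rfl⟩
    exact ⟨⟨u, hc.mem_T₂_of_color_eq hS hnbr hu s.2 hus⟩, hus, fun u' hu's =>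
      Subtype.ext (hinj u'.2.1 hu (hu's.trans hus.symm))⟩

end Necessity

/-! ### Sufficiency: colouring the boundary along a perfect matching -/

/-- The colour function `c₀` agrees with `c'`, and it gives the vertex of `δT \ S'` that is matched
to `u ∈ T₂` the colour of `u`. -/
structure ExtendsAlong (e : T₂ G S' c' ≃ freeBoundary G S') (c₀ : V → ℕ+) : Prop where
  extends_pre : Extends c' c₀
  matched : ∀ u, c₀ (e u) = c₀ u

section Sufficiency

variable {e : T₂ G S' c' ≃ freeBoundary G S'} {c₀ : V → ℕ+}

theorem exists_extendsAlong (e : T₂ G S' c' ≃ freeBoundary G S') :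
    ∃ c₀ : V → ℕ+, ExtendsAlong e c₀ := by
  classical
  let colour : ↥(S' ∪ denseSet G) → ℕ+ := c'
  let c₀ : V → ℕ+ := fun v =>
    if h : v ∈ S' ∪ denseSet G then colour ⟨v, h⟩
    else if h : v ∈ freeBoundary G S' then colour ⟨e.symm ⟨v, h⟩, Or.inr (e.symm ⟨v, h⟩).2.1⟩
    else 1
  have hpre : Extends c' c₀ := fun v => dif_pos v.2
  refine ⟨c₀, hpre, fun u => ?_⟩
  have hfree : (e u : V) ∉ S' ∪ denseSet G := fun h => h.elim (e u).2.2 (e u).2.1.2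
  rw [hpre ⟨u, Or.inr u.2.1⟩]
  calc c₀ (e u) = colour ⟨e.symm (e u), Or.inr (e.symm (e u)).2.1⟩ :=
        (dif_neg hfree).trans (dif_pos (e u).2)
    _ = colour ⟨u, Or.inr u.2.1⟩ := by simp only [Equiv.symm_apply_apply]

theorem not_adj_and_adj_of_auxAdj [Finite V] (hG : IsTight G)
    (he : ∀ u : T₂ G S' c', AuxAdj G S' c' u (e u)) {w : V} (hw : w ∈ denseSet G) (u : T₂ G S' c')
    (hwu : w ≠ u) : ¬ (G.Adj w u ∧ G.Adj w (e u)) := by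
  rintro ⟨hadj, hadj'⟩
  by_cases hw' : w ∈ T₂ G S' c' ∪ T' G S' c'
  · exact (he u).2 w ⟨hw', hwu⟩ ⟨hadj.symm, hadj'.symm⟩
  · have : (e u : V) ∈ G.neighborSet w := hadj'
    rw [hG.neighborSet_of_mem_T₁ (mem_T₁_of_notMem hw hw')] at this
    exact (e u).2.1.2 this.1

namespace ExtendsAlong

variable (h : ExtendsAlong e c₀)

include h

theorem exists_dense_color_eq (hcol : ColoursUsedOnDense c') {x : V}
    (hx : x ∈ denseSet G ∪ outerBoundary G (denseSet G)) : ∃ u ∈ denseSet G, c₀ u = c₀ x := by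
  rcases hx with hx | hx
  · exact ⟨x, hx, rfl⟩
  · by_cases hxS : x ∈ S'
    · exact h.extends_pre.coloursUsedOnDense_iff.1 hcol x hxS
    · obtain ⟨u, hu⟩ := e.surjective ⟨x, hx, hxS⟩
      exact ⟨u, u.2.1, by rw [← h.matched, hu]⟩

theorem eq_or_eq_matched (hp : IsPartialBColouring G S' c') {x : V}
    (hx : x ∈ denseSet G ∪ outerBoundary G (denseSet G)) (u : T₂ G S' c') (hxu : c₀ x = c₀ u) :
    x = u ∨ x = e u := by
  have hinj := h.extends_pre.injOn_denseSet hp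
  rcases hx with hx | hx
  · exact Or.inl (hinj hx u.2.1 hxu)
  · by_cases hxS : x ∈ S'
    · exact absurd (Or.inr (h.extends_pre.mem_T'_iff.2 ⟨u.2.1, x, hxS, hxu.symm⟩)) u.2.2
    · obtain ⟨u', hu'⟩ := e.surjective ⟨x, hx, hxS⟩
      have : u' = u := Subtype.ext (hinj u'.2.1 u.2.1 (by rw [← h.matched, hu', ← hxu]))
      exact Or.inr (by rw [← this, hu'])

theorem mem_domain_of_notMem_T₂ (hp : IsPartialBColouring G S' c') {u x : V}
    (hu : u ∈ denseSet G) (huT₂ : u ∉ T₂ G S' c')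
    (hx : x ∈ denseSet G ∪ outerBoundary G (denseSet G)) (hxu : c₀ x = c₀ u) :
    x ∈ S' ∪ denseSet G := by
  by_contra hx'
  rw [Set.mem_union, not_or] at hx'
  obtain ⟨u', hu'⟩ := e.surjective ⟨x, hx.resolve_left hx'.2, hx'.1⟩
  have : (u' : V) = u :=
    h.extends_pre.injOn_denseSet hp u'.2.1 hu (by rw [← h.matched, hu', ← hxu])
  exact huT₂ (this ▸ u'.2)

theorem ne_of_adj (hp : IsPartialBColouring G S' c')
    (he : ∀ u : T₂ G S' c', AuxAdj G S' c' u (e u)) {v w : V}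
    (hv : v ∈ denseSet G ∪ outerBoundary G (denseSet G))
    (hw : w ∈ denseSet G ∪ outerBoundary G (denseSet G)) (hvw : G.Adj v w) : c₀ v ≠ c₀ w := by
  have free {s x : V} (hs : s ∈ freeBoundary G S')
      (hx : x ∈ denseSet G ∪ outerBoundary G (denseSet G)) (hsx : G.Adj s x) : c₀ s ≠ c₀ x := by
    obtain ⟨u, hu⟩ := e.surjective ⟨s, hs⟩
    obtain rfl : (e u : V) = s := congrArg Subtype.val hu
    intro heq
    rcases h.eq_or_eq_matched hp hx u (by rw [← heq, h.matched]) with rfl | rfl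
    · exact (he u).1 hsx.symm
    · exact G.loopless.irrefl _ hsx
  by_cases hv' : v ∈ S' ∪ denseSet G
  · by_cases hw' : w ∈ S' ∪ denseSet G
    · exact fun heq => c'.valid (v := ⟨v, hv'⟩) (w := ⟨w, hw'⟩) hvw
        ((h.extends_pre.eq_iff ⟨v, hv'⟩ ⟨w, hw'⟩).2 heq)
    · rw [Set.mem_union, not_or] at hw'
      exact (free ⟨hw.resolve_left hw'.2, hw'.1⟩ hv hvw.symm).symm
  · rw [Set.mem_union, not_or] at hv'
    exact free ⟨hv.resolve_left hv'.2, hv'.1⟩ hw hvw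

theorem injOn_neighborSet [Finite V] (hG : IsTight G) (hp : IsPartialBColouring G S' c')
    (hcol : ColoursUsedOnDense c') (he : ∀ u : T₂ G S' c', AuxAdj G S' c' u (e u)) {w : V}
    (hw : w ∈ denseSet G) : Set.InjOn c₀ (G.neighborSet w) := by
  intro x hx y hy hxy
  have hxN := neighborSet_subset_union_outerBoundary hw hx
  have hyN := neighborSet_subset_union_outerBoundary hw hy
  obtain ⟨u, hu, hux⟩ := h.exists_dense_color_eq hcol hxN
  have huy : c₀ u = c₀ y := hux.trans hxy
  have hwu : w ≠ u := by
    rintro rfl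
    exact h.ne_of_adj hp he (Or.inl hw) hxN hx hux
  by_cases huT₂ : u ∈ T₂ G S' c'
  · lift u to T₂ G S' c' using huT₂
    have hnadj := not_adj_and_adj_of_auxAdj hG he hw u hwu
    rcases h.eq_or_eq_matched hp hxN u hux.symm with rfl | rfl <;>
      rcases h.eq_or_eq_matched hp hyN u huy.symm with rfl | rfl
    exacts [rfl, absurd ⟨hx, hy⟩ hnadj, absurd ⟨hy, hx⟩ hnadj, rfl]
  · have hx' := h.mem_domain_of_notMem_T₂ hp hu huT₂ hxN hux.symm
    have hy' := h.mem_domain_of_notMem_T₂ hp hu huT₂ hyN huy.symm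
    by_cases huT' : u ∈ T' G S' c'
    · exact h.extends_pre.eq_of_mem_T' hp huT' hw hwu hx' hy' hx hy hux.symm huy.symm
    · have eq_u {z : V} (hz : z ∈ S' ∪ denseSet G) (huz : c₀ u = c₀ z) : z = u :=
        h.extends_pre.injOn_denseSet hp
          (hz.resolve_left fun hzS => huT' (h.extends_pre.mem_T'_iff.2 ⟨hu, z, hzS, huz⟩))
          hu huz.symm
      rw [eq_u hx' hux, eq_u hy' huy]

theorem exists_isBColouring [Finite V] (hG : IsTight G) (hp : IsPartialBColouring G S' c')
    (hcol : ColoursUsedOnDense c') (he : ∀ u : T₂ G S' c', AuxAdj G S' c' u (e u)) :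
    ∃ c : G.Coloring ℕ+, IsBColouring c ∧
      Set.EqOn c c₀ (denseSet G ∪ outerBoundary G (denseSet G)) := by
  have hinj := h.extends_pre.injOn_denseSet hp
  have hcard : (c₀ '' denseSet G).ncard = mDegree G := by rw [hinj.ncard_image, hG.1]
  obtain ⟨c, hrange, hc⟩ := exists_greedy_extension (C := c₀ '' denseSet G)
    (fun x hx => h.exists_dense_color_eq hcol hx)
    (fun v hv w hw => h.ne_of_adj hp he hv hw) (fun v hv => by
      have : ¬ mDegree G ≤ deg G v + 1 := fun hdense => hv (Or.inl hdense)
      omega)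
  have hc_dense : Set.EqOn c c₀ (denseSet G) := hc.mono Set.subset_union_left
  refine ⟨c, (hG.isBColouring_iff ((Set.EqOn.injOn_iff hc_dense).2 hinj)).2 ⟨?_, ?_⟩, hc⟩
  · rwa [hc_dense.image_eq]
  · exact fun w hw => (Set.EqOn.injOn_iff (hc.mono (neighborSet_subset_union_outerBoundary hw))).2
      (h.injOn_neighborSet hG hp hcol he hw)

theorem isBPrecolouringExtension [Finite V] (hS : S' ⊆ outerBoundary G (denseSet G))
    (hp : IsPartialBColouring G S' c') {c : G.Coloring ℕ+} (hb : IsBColouring c)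
    (hc : Set.EqOn c c₀ (denseSet G ∪ outerBoundary G (denseSet G))) :
    IsBPrecolouringExtension G S' c' c where
  isBColouring := hb
  extends_pre v := (hc (v.2.elim (fun hv => Or.inr (hS hv)) Or.inl)).trans (h.extends_pre v)
  boundary_class i hi := by
    refine Set.disjoint_left.2 fun x (hxi : c x = i) hx => ?_
    obtain ⟨u, hu⟩ := e.surjective ⟨x, hx⟩
    obtain rfl : (e u : V) = x := congrArg Subtype.val hu
    have hsub : c.colorClass i ∩ outerBoundary G (denseSet G) ⊆ {(e u : V)} := by
      rintro y ⟨hyi, hy⟩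
      have hyu : c₀ y = c₀ u := by
        rw [← h.matched, ← hc (Or.inr hy), ← hc (Or.inr hx.1), hxi]
        exact hyi
      exact (h.eq_or_eq_matched hp (Or.inr hy) u hyu).resolve_left fun h' => hy.2 (h' ▸ u.2.1)
    have := hi.trans (Set.ncard_le_ncard hsub)
    rw [Set.ncard_singleton] at this
    omega

end ExtendsAlong

end Sufficiency

theorem hasBPrecolouringExtension_iff [Finite V] (hG : IsTight G)
    (hS : S' ⊆ outerBoundary G (denseSet G)) (hp : IsPartialBColouring G S' c') :
    HasBPrecolouringExtension G S' c' ↔ ColoursUsedOnDense c' ∧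
      PerfectlyMatchable fun (u : T₂ G S' c') (s : freeBoundary G S') => AuxAdj G S' c' u s := by
  constructor
  · rintro ⟨c, hc⟩
    exact hc.coloursUsedOnDense_and_perfectlyMatchable hG hS hp
  · rintro ⟨hcol, e, he⟩
    obtain ⟨c₀, hc₀⟩ := exists_extendsAlong e
    obtain ⟨c, hb, hc⟩ := hc₀.exists_isBColouring hG hp hcol he
    exact ⟨c, hc₀.isBPrecolouringExtension hS hp hb hc⟩

end BCol

/-! ### A language of bounded loops -/

namespace RAM

/-- The register of the variable `x` of an `Exp` or `Stmt`. Register `0` holds the loop bound, and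
the remaining even registers are temporary. -/
def varReg (x : ℕ) : ℕ := 2 * x + 1

/-- The `k`-th temporary register. -/
def tmpReg (k : ℕ) : ℕ := 2 * k + 2

namespace State

theorem reg_setReg (s : State) (x n y : ℕ) :
    (s.setReg x n).reg y = if y = x then n else s.reg y :=
  Function.update_apply ..

@[simp]
theorem arr_setReg (s : State) (x n : ℕ) : (s.setReg x n).arr = s.arr := rfl

theorem arr_setArr (s : State) (a i n b j : ℕ) :
    (s.setArr a i n).arr b j = if b = a ∧ j = i then n else s.arr b j := by
  simp only [setArr, Function.update_apply]
  split_ifs <;> simp_all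

@[simp]
theorem reg_setArr (s : State) (a i n : ℕ) : (s.setArr a i n).reg = s.reg := rfl

/-- The number of iterations of the loops of an `Exp` or `Stmt`. -/
def bound (s : State) : ℕ := s.reg 0

/-- The value of a variable. -/
def var (s : State) (x : ℕ) : ℕ := s.reg (varReg x)

/-- Assignment to a variable. -/
def setVar (s : State) (x n : ℕ) : State := s.setReg (varReg x) n

/-- Assignment to a temporary register. -/
def setTmp (s : State) (k n : ℕ) : State := s.setReg (tmpReg k) n

section Simp

variable (s : State) (x y k n a i : ℕ)

@[simp] theorem var_setVar_self : (s.setVar x n).var x = n := by simp [var, setVar, reg_setReg]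

theorem var_setVar : (s.setVar x n).var y = if y = x then n else s.var y := by
  simp [var, setVar, reg_setReg, varReg]

@[simp] theorem bound_setVar : (s.setVar x n).bound = s.bound := by
  simp [bound, setVar, reg_setReg, varReg]

@[simp] theorem arr_setVar : (s.setVar x n).arr = s.arr := rfl

@[simp] theorem var_setTmp : (s.setTmp k n).var x = s.var x := by
  simp only [var, setTmp, reg_setReg, varReg, tmpReg]
  exact if_neg (by omega)

@[simp] theorem bound_setTmp : (s.setTmp k n).bound = s.bound := by
  simp [bound, setTmp, reg_setReg, tmpReg]

@[simp] theorem arr_setTmp : (s.setTmp k n).arr = s.arr := rfl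

@[simp] theorem var_setArr : (s.setArr a i n).var x = s.var x := rfl

theorem setVar_setTmp (m : ℕ) : (s.setTmp k m).setVar x n = (s.setVar x n).setTmp k m := by
  simp only [setVar, setTmp, setReg, State.mk.injEq, and_true]
  exact Function.update_comm (by simp only [varReg, tmpReg]; omega) ..

theorem setArr_setTmp (m : ℕ) : (s.setTmp k m).setArr a i n = (s.setArr a i n).setTmp k m := rfl

end Simp

end State

/-- The registers that programs which use the temporary registers from the `k`-th one on have to
respect. -/
def Visible (k r : ℕ) : Prop := r % 2 = 1 ∨ r < tmpReg k

theorem visible_zero (k : ℕ) : Visible k 0 := Or.inr (Nat.succ_pos _)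

theorem visible_varReg (k x : ℕ) : Visible k (varReg x) := Or.inl (by simp only [varReg]; omega)

theorem visible_tmpReg {k j : ℕ} : Visible k (tmpReg j) ↔ j < k := by
  simp only [Visible, tmpReg]
  omega

theorem Visible.mono {k l r : ℕ} (h : Visible k r) (hkl : k ≤ l) : Visible l r := by
  simp only [Visible, tmpReg] at h ⊢
  omega

theorem Visible.of_succ {k r : ℕ} (h : Visible (k + 1) r) (hr : r ≠ tmpReg k) : Visible k r := by
  simp only [Visible, tmpReg] at h hr ⊢
  omega

/-- The states agree on the arrays and on the registers that are visible at level `k`. -/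
structure State.Agree (k : ℕ) (s s' : State) : Prop where
  arr : s.arr = s'.arr
  reg : ∀ r, Visible k r → s.reg r = s'.reg r

/-- Started in a state that agrees with `s` at level `k`, the program `p` terminates after `t` steps
in a state that agrees with `s'` at level `l`. -/
def Runs (k l : ℕ) (p : Prog) (t : ℕ) (s s' : State) : Prop :=
  ∀ r : State, r.Agree k s → ∃ r', Exec p r t r' ∧ r'.Agree l s'

namespace Runs

variable {k l m t t' x y z : ℕ} {p q : Prog} {s s' s'' : State}

theorem seq (hp : Runs k l p t s s') (hq : Runs l m q t' s' s'') :
    Runs k m (.seq p q) (t + t') s s'' := fun r hr => by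
  obtain ⟨r', hrun, hr'⟩ := hp r hr
  obtain ⟨r'', hrun', hr''⟩ := hq r' hr'
  exact ⟨r'', hrun.seq hrun', hr''⟩

theorem congr (h : Runs k l p t s s') (ht : t = t') (hs : s'.Agree m s'') (hml : m ≤ l) :
    Runs k m p t' s s'' := fun r hr => by
  obtain ⟨r', hrun, hr'⟩ := h r hr
  exact ⟨r', ht ▸ hrun, hr'.arr.trans hs.arr,
    fun x hx => (hr'.reg x (hx.mono hml)).trans (hs.reg x hx)⟩

theorem of_exec_setReg (f : State → ℕ) (hexec : ∀ s, Exec p s 1 (s.setReg x (f s)))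
    (hf : ∀ s s' : State, s.Agree k s' → f s = f s')
    (hx : ∀ r, Visible l r → r ≠ x → Visible k r) : Runs k l p 1 s (s.setReg x (f s)) :=
  fun r hr => by
    refine ⟨_, hexec r, hr.arr, fun y hy => ?_⟩
    rw [State.reg_setReg, State.reg_setReg, hf r s hr]
    split_ifs with hyx
    · rfl
    · exact hr.reg y (hx y hy hyx)

theorem const (c : ℕ) (hx : ∀ r, Visible l r → r ≠ x → Visible k r) :
    Runs k l (.const x c) 1 s (s.setReg x c) :=
  of_exec_setReg (fun _ => c) (fun _ => .const ..) (fun _ _ _ => rfl) hx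

theorem copy (hy : Visible k y) (hx : ∀ r, Visible l r → r ≠ x → Visible k r) :
    Runs k l (.copy x y) 1 s (s.setReg x (s.reg y)) :=
  of_exec_setReg (fun s => s.reg y) (fun _ => .copy ..) (fun _ _ h => h.reg y hy) hx

theorem add (hy : Visible k y) (hz : Visible k z) (hx : ∀ r, Visible l r → r ≠ x → Visible k r) :
    Runs k l (.add x y z) 1 s (s.setReg x (s.reg y + s.reg z)) :=
  of_exec_setReg (fun s => s.reg y + s.reg z) (fun _ => .add ..)
    (fun _ _ h => congrArg₂ _ (h.reg y hy) (h.reg z hz)) hx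

theorem sub (hy : Visible k y) (hz : Visible k z) (hx : ∀ r, Visible l r → r ≠ x → Visible k r) :
    Runs k l (.sub x y z) 1 s (s.setReg x (s.reg y - s.reg z)) :=
  of_exec_setReg (fun s => s.reg y - s.reg z) (fun _ => .sub ..)
    (fun _ _ h => congrArg₂ _ (h.reg y hy) (h.reg z hz)) hx

theorem load (a : ℕ) (hy : Visible k y) (hx : ∀ r, Visible l r → r ≠ x → Visible k r) :
    Runs k l (.load x a y) 1 s (s.setReg x (s.arr a (s.reg y))) :=
  of_exec_setReg (fun s => s.arr a (s.reg y)) (fun _ => .load ..)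
    (fun _ _ h => by rw [h.arr, h.reg y hy]) hx

theorem store (a : ℕ) (hx : Visible k x) (hy : Visible k y) :
    Runs k k (.store a x y) 1 s (s.setArr a (s.reg x) (s.reg y)) := fun r hr => by
  refine ⟨_, .store .., ?_, hr.reg⟩
  simp only [State.setArr, hr.arr, hr.reg x hx, hr.reg y hy]

theorem loop_zero (hx : Visible k x) (hs : s.reg x = 0) : Runs k k (.loop x p) 1 s s :=
  fun r hr => ⟨r, .loop_zero ((hr.reg x hx).trans hs), hr⟩

theorem loop_pos (hx : Visible k x) (hs : s.reg x ≠ 0) (hp : Runs k k p t s s')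
    (hl : Runs k l (.loop x p) t' s' s'') : Runs k l (.loop x p) (t + t' + 1) s s'' :=
  fun r hr => by
    obtain ⟨r', hrun, hr'⟩ := hp r hr
    obtain ⟨r'', hrun', hr''⟩ := hl r' hr'
    exact ⟨r'', .loop_pos (by rwa [hr.reg x hx]) hrun hrun', hr''⟩

end Runs

/-- Repeat `p` as many times as the bound says, with the `k`-th temporary register as counter. -/
def forBound (k : ℕ) (p : Prog) : Prog :=
  .seq (.copy (tmpReg k) 0) <| .loop (tmpReg k) <| .seq p <| .seq (.const (tmpReg (k + 1)) 1) <|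
    .sub (tmpReg k) (tmpReg k) (tmpReg (k + 1))

theorem Runs.forBound {k t : ℕ} {p : Prog} {S : ℕ → State}
    (hp : ∀ i m, Runs (k + 1) (k + 1) p t ((S i).setTmp k m) ((S (i + 1)).setTmp k m)) :
    Runs k k (forBound k p) ((S 0).bound * (t + 3) + 2) (S 0) (S (S 0).bound) := by
  have loop (m : ℕ) : ∀ i, Runs (k + 1) (k + 1)
      (.loop (tmpReg k) <| .seq p <| .seq (.const (tmpReg (k + 1)) 1) <|
        .sub (tmpReg k) (tmpReg k) (tmpReg (k + 1)))
      (m * (t + 3) + 1) ((S i).setTmp k m) ((S (i + m)).setTmp k 0) := by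
    induction m with
    | zero => exact fun i => (Runs.loop_zero (visible_tmpReg.2 k.lt_succ_self)
        (by simp [State.setTmp, State.reg_setReg])).congr (by simp) ⟨rfl, fun _ _ => rfl⟩ le_rfl
    | succ m ih =>
      intro i
      have step := (hp i (m + 1)).seq <| (Runs.const (l := k + 2) 1 fun _ => Visible.of_succ).seq <|
        Runs.sub (x := tmpReg k) (y := tmpReg k) (z := tmpReg (k + 1)) (l := k + 2)
          (visible_tmpReg.2 (by omega)) (visible_tmpReg.2 (by omega)) fun _ h _ => h
      refine (Runs.loop_pos (visible_tmpReg.2 k.lt_succ_self)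
        (by simp [State.setTmp, State.reg_setReg])
        (step.congr rfl (s'' := (S (i + 1)).setTmp k m) ?_ (by omega)) (ih (i + 1))).congr
        (by ring) ?_ le_rfl
      · refine ⟨rfl, fun r hr => ?_⟩
        simp only [State.setTmp, State.reg_setReg, tmpReg, Visible] at hr ⊢
        grind
      · rw [show i + 1 + m = i + (m + 1) by ring]
        exact ⟨rfl, fun _ _ => rfl⟩
  have run := loop (S 0).bound 0
  rw [Nat.zero_add] at run
  refine ((Runs.copy (visible_zero k) fun _ => Visible.of_succ).seq run).congr (by ring)
    ⟨rfl, fun r hr => ?_⟩ (Nat.le_succ k)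
  rw [State.setTmp, State.reg_setReg, if_neg]
  rintro rfl
  exact absurd (visible_tmpReg.1 hr) (lt_irrefl k)

/-- Expressions over variables, arrays and the loop bound. -/
inductive Exp : Type
  | const (c : ℕ) : Exp
  | var (x : ℕ) : Exp
  | bound : Exp
  | add (e f : Exp) : Exp
  | sub (e f : Exp) : Exp
  | arr (a : ℕ) (e : Exp) : Exp
  /-- the sum of the values of `e` as the variable `x` runs through the numbers below the bound -/
  | sum (x : ℕ) (e : Exp) : Exp

namespace Exp

/-- The value of an expression. -/
def eval : Exp → State → ℕ
  | const c, _ => c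
  | var x, s => s.var x
  | bound, s => s.bound
  | add e f, s => eval e s + eval f s
  | sub e f, s => eval e s - eval f s
  | arr a e, s => s.arr a (eval e s)
  | sum x e, s => ∑ i ∈ Finset.range s.bound, eval e (s.setVar x i)

/-- Compilation of an expression. The temporary registers from the `k`-th one on are scratch space,
the first of which receives the value. -/
def compile : Exp → ℕ → Prog
  | const c, k => .const (tmpReg k) c
  | var x, k => .copy (tmpReg k) (varReg x)
  | bound, k => .copy (tmpReg k) 0
  | add e f, k => .seq (.seq (compile e k) (compile f (k + 1)))
      (.add (tmpReg k) (tmpReg k) (tmpReg (k + 1)))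
  | sub e f, k => .seq (.seq (compile e k) (compile f (k + 1)))
      (.sub (tmpReg k) (tmpReg k) (tmpReg (k + 1)))
  | arr a e, k => .seq (compile e k) (.load (tmpReg k) a (tmpReg k))
  | sum x e, k =>
      .seq (.seq (.copy (tmpReg k) (varReg x)) <|
        .seq (.const (tmpReg (k + 1)) 0) (.const (varReg x) 0)) <|
      .seq (forBound (k + 2) <|
        .seq (compile e (k + 3)) <|
        .seq (.add (tmpReg (k + 1)) (tmpReg (k + 1)) (tmpReg (k + 3))) <|
        .seq (.const (tmpReg (k + 3)) 1) <|
        .add (varReg x) (varReg x) (tmpReg (k + 3))) <|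
      .seq (.copy (varReg x) (tmpReg k)) <|
      .copy (tmpReg k) (tmpReg (k + 1))

/-- The running time of a compiled expression as a polynomial in the bound. -/
noncomputable def cost : Exp → Polynomial ℕ
  | const _ => 1
  | var _ => 1
  | bound => 1
  | add e f => cost e + cost f + 1
  | sub e f => cost e + cost f + 1
  | arr _ e => cost e + 1
  | sum _ e => Polynomial.X * (cost e + 6) + 7

@[simp]
theorem eval_setTmp (e : Exp) (s : State) (k n : ℕ) : e.eval (s.setTmp k n) = e.eval s := by
  induction e generalizing s <;> simp_all [eval, State.setVar_setTmp]

/-- The compiled expression leaves its value in the first of its temporary registers and respects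
everything visible below it. -/
def Correct (e : Exp) : Prop :=
  ∀ k s, Runs k (k + 1) (e.compile k) (e.cost.eval s.bound) s (s.setTmp k (e.eval s))

theorem Correct.pair {e f : Exp} (he : e.Correct) (hf : f.Correct) (k : ℕ) (s : State) :
    Runs k (k + 2) (.seq (e.compile k) (f.compile (k + 1)))
      (e.cost.eval s.bound + f.cost.eval s.bound) s
      ((s.setTmp k (e.eval s)).setTmp (k + 1) (f.eval s)) := by
  simpa using (he k s).seq (hf (k + 1) (s.setTmp k (e.eval s)))

/-- The state of the machine when the loop of `sum x e` has been run `i` times. -/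
def sumState (x : ℕ) (e : Exp) (k : ℕ) (s : State) (i : ℕ) : State :=
  ((s.setVar x i).setTmp k (s.var x)).setTmp (k + 1) (∑ j ∈ Finset.range i, e.eval (s.setVar x j))

theorem Correct.sum_body {e : Exp} (he : e.Correct) (x k : ℕ) (s : State) (i m : ℕ) :
    Runs (k + 3) (k + 3)
      (.seq (e.compile (k + 3)) <| .seq (.add (tmpReg (k + 1)) (tmpReg (k + 1)) (tmpReg (k + 3))) <|
        .seq (.const (tmpReg (k + 3)) 1) <| .add (varReg x) (varReg x) (tmpReg (k + 3)))
      (e.cost.eval s.bound + 3) ((sumState x e k s i).setTmp (k + 2) m)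
      ((sumState x e k s (i + 1)).setTmp (k + 2) m) := by
  have run := (he (k + 3) ((sumState x e k s i).setTmp (k + 2) m)).seq <|
    (Runs.add (x := tmpReg (k + 1)) (y := tmpReg (k + 1)) (z := tmpReg (k + 3)) (l := k + 4)
      (visible_tmpReg.2 (by omega)) (visible_tmpReg.2 (by omega)) fun _ h _ => h).seq <|
    (Runs.const (x := tmpReg (k + 3)) (l := k + 4) 1 fun _ h _ => h).seq <|
    Runs.add (x := varReg x) (y := varReg x) (z := tmpReg (k + 3)) (l := k + 4)
      (visible_varReg _ x) (visible_tmpReg.2 (by omega)) fun _ h _ => h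
  refine run.congr (by simp [sumState]) ⟨rfl, fun r hr => ?_⟩ (by omega)
  simp only [sumState, eval_setTmp, Finset.sum_range_succ]
  simp only [State.setTmp, State.setVar, State.reg_setReg, tmpReg, varReg, Visible] at hr ⊢
  split_ifs <;> omega

theorem Correct.sum {e : Exp} (he : e.Correct) (x : ℕ) : (sum x e).Correct := fun k s => by
  have start : Runs k (k + 2)
      (.seq (.copy (tmpReg k) (varReg x)) <| .seq (.const (tmpReg (k + 1)) 0) (.const (varReg x) 0))
      (1 + (1 + 1)) s (sumState x e k s 0) := by
    refine ((Runs.copy (visible_varReg k x) fun _ => .of_succ).seq <|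
      (Runs.const (l := k + 2) 0 fun _ => .of_succ).seq <|
      Runs.const (l := k + 2) 0 fun _ h _ => h).congr rfl ⟨rfl, fun r _ => ?_⟩ le_rfl
    simp only [sumState, State.setTmp, State.setVar, State.var, State.reg_setReg, tmpReg, varReg,
      Finset.range_zero, Finset.sum_empty]
    split_ifs <;> omega
  have bound_start : (sumState x e k s 0).bound = s.bound := by simp [sumState]
  have loop := Runs.forBound (S := sumState x e k s) (he.sum_body x k s)
  rw [bound_start] at loop
  have finish := (Runs.copy (s := sumState x e k s s.bound) (x := varReg x) (y := tmpReg k)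
    (l := k + 2) (visible_tmpReg.2 (by omega)) fun _ h _ => h).seq <|
    Runs.copy (x := tmpReg k) (y := tmpReg (k + 1)) (l := k + 2) (visible_tmpReg.2 (by omega))
      fun _ h _ => h
  refine (start.seq (loop.seq finish)).congr (by simp [cost]; ring) ⟨rfl, fun r hr => ?_⟩ (by omega)
  simp only [sumState, eval, State.setTmp, State.setVar, State.var, State.reg_setReg, tmpReg,
    varReg, Visible] at hr ⊢
  grind

theorem correct : ∀ e : Exp, e.Correct
  | const c, k, s => by
    rw [cost, Polynomial.eval_one]
    exact .const c fun _ => .of_succ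
  | var x, k, s => by
    rw [cost, Polynomial.eval_one]
    exact .copy (visible_varReg k x) fun _ => .of_succ
  | bound, k, s => by
    rw [cost, Polynomial.eval_one]
    exact .copy (visible_zero k) fun _ => .of_succ
  | add e f, k, s => by
    refine ((e.correct.pair f.correct k s).seq <| Runs.add (l := k + 2)
      (visible_tmpReg.2 (by omega)) (visible_tmpReg.2 (by omega)) fun _ h _ => h).congr
      (by simp [cost]) ⟨rfl, fun r hr => ?_⟩ (by omega)
    simp only [State.setTmp, State.reg_setReg, tmpReg, Visible, eval] at hr ⊢
    split_ifs <;> omega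
  | sub e f, k, s => by
    refine ((e.correct.pair f.correct k s).seq <| Runs.sub (l := k + 2)
      (visible_tmpReg.2 (by omega)) (visible_tmpReg.2 (by omega)) fun _ h _ => h).congr
      (by simp [cost]) ⟨rfl, fun r hr => ?_⟩ (by omega)
    simp only [State.setTmp, State.reg_setReg, tmpReg, Visible, eval] at hr ⊢
    split_ifs <;> omega
  | arr a e, k, s => by
    refine ((e.correct k s).seq <| Runs.load (l := k + 1) a (visible_tmpReg.2 k.lt_succ_self)
      fun _ h _ => h).congr (by simp [cost]) ⟨rfl, fun r _ => ?_⟩ le_rfl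
    simp only [State.setTmp, State.reg_setReg, State.arr_setReg, eval, if_true]
    split_ifs <;> rfl
  | sum x e, k, s => e.correct.sum x k s

end Exp

/-- Statements: assignments to variables and to array cells, and loops whose number of iterations is
the loop bound. -/
inductive Stmt : Type
  | assign (x : ℕ) (e : Exp) : Stmt
  | store (a : ℕ) (e f : Exp) : Stmt
  | seq (p q : Stmt) : Stmt
  | rep (p : Stmt) : Stmt

namespace Stmt

/-- The effect of a statement. -/
def run : Stmt → State → State
  | assign x e, s => s.setVar x (e.eval s)
  | store a e f, s => s.setArr a (e.eval s) (f.eval s)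
  | seq p q, s => run q (run p s)
  | rep p, s => (run p)^[s.bound] s

/-- Compilation of a statement, with the temporary registers from the `k`-th one on as scratch
space. -/
def compile : Stmt → ℕ → Prog
  | assign x e, k => .seq (e.compile k) (.copy (varReg x) (tmpReg k))
  | store a e f, k => .seq (.seq (e.compile k) (f.compile (k + 1)))
      (.store a (tmpReg k) (tmpReg (k + 1)))
  | seq p q, k => .seq (compile p k) (compile q k)
  | rep p, k => forBound k (compile p (k + 1))

/-- The running time of a compiled statement as a polynomial in the bound. -/
noncomputable def cost : Stmt → Polynomial ℕ
  | assign _ e => e.cost + 1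
  | store _ e f => e.cost + f.cost + 1
  | seq p q => cost p + cost q
  | rep p => Polynomial.X * (cost p + 3) + 2

@[simp]
theorem bound_run (p : Stmt) (s : State) : (p.run s).bound = s.bound := by
  induction p generalizing s with
  | assign x e => exact State.bound_setVar ..
  | store a e f => rfl
  | seq p q hp hq => rw [run, hq, hp]
  | rep p hp =>
    rw [run]
    exact Function.Iterate.rec (fun r : State => r.bound = s.bound) rfl
      (fun r hr => (hp r).trans hr) s.bound

theorem bound_iterate_run (p : Stmt) (s : State) (i : ℕ) : (p.run^[i] s).bound = s.bound := by
  induction i with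
  | zero => rfl
  | succ i ih => rw [Function.iterate_succ_apply', bound_run, ih]

theorem run_setTmp (p : Stmt) (s : State) (k n : ℕ) :
    p.run (s.setTmp k n) = (p.run s).setTmp k n := by
  induction p generalizing s with
  | assign x e => simp only [run, Exp.eval_setTmp, State.setVar_setTmp]
  | store a e f => simp only [run, Exp.eval_setTmp, State.setArr_setTmp]
  | seq p q hp hq => rw [run, run, hp, hq]
  | rep p hp =>
    rw [run, run, State.bound_setTmp]
    exact (Function.Semiconj.iterate_right (f := fun r : State => r.setTmp k n)
      (fun r => (hp r).symm) s.bound s).symm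

theorem correct : ∀ (p : Stmt) (k : ℕ) (s : State),
    Runs k k (p.compile k) (p.cost.eval s.bound) s (p.run s)
  | assign x e, k, s => by
    refine ((e.correct k s).seq <| Runs.copy (l := k + 1) (visible_tmpReg.2 k.lt_succ_self)
      fun _ h _ => h).congr (by simp [cost]) ⟨rfl, fun r hr => ?_⟩ k.le_succ
    simp only [run, State.setTmp, State.setVar, State.reg_setReg, tmpReg, varReg, Visible] at hr ⊢
    split_ifs <;> omega
  | store a e f, k, s => by
    refine ((e.correct.pair f.correct k s).seq <| Runs.store (k := k + 2) a
      (visible_tmpReg.2 (by omega)) (visible_tmpReg.2 (by omega))).congr (by simp [cost])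
      ⟨?_, fun r hr => ?_⟩ (by omega)
    · simp [run, State.setTmp, State.setArr, State.reg_setReg, tmpReg]
    · simp only [run, State.setTmp, State.reg_setArr, State.reg_setReg, tmpReg, Visible] at hr ⊢
      split_ifs <;> omega
  | seq p q, k, s => by
    have run := (p.correct k s).seq (q.correct k (p.run s))
    rw [bound_run, ← Polynomial.eval_add] at run
    exact run
  | rep p, k, s => by
    refine (Runs.forBound (t := p.cost.eval s.bound) (S := fun i => p.run^[i] s)
      fun i m => ?_).congr (by simp [cost]) ⟨rfl, fun _ _ => rfl⟩ le_rfl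
    simpa only [run_setTmp, State.bound_setTmp, bound_iterate_run,
      Function.iterate_succ_apply'] using p.correct (k + 1) ((p.run^[i] s).setTmp k m)

end Stmt

theorem monotone_polynomial_eval {R : Type*} [Semiring R] [PartialOrder R] [IsOrderedRing R]
    [CanonicallyOrderedAdd R] (q : Polynomial R) : Monotone fun x => q.eval x := fun x y h => by
  simp only [Polynomial.eval_eq_sum, Polynomial.sum_def]
  gcongr

theorem length_le_inputSize (l : List ℕ) : l.length ≤ inputSize l := by
  induction l with
  | nil => exact Nat.zero_le _
  | cons a l ih =>
    simp only [inputSize, List.map_cons, List.sum_cons, List.length_cons] at ih ⊢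
    omega

/-- The state in which the loop bound is the first entry of `l` and the array `0` holds `l`. -/
def startState (l : List ℕ) : State := (initState l).setReg 0 (l.getD 0 0)

theorem DecidableInPolyTime.of_stmt {α : Type*} {enc : α → List ℕ} {P : α → Prop} (p : Stmt)
    (e : Exp) (hlen : ∀ a, (enc a).getD 0 0 ≤ (enc a).length)
    (h : ∀ a, e.eval (p.run (startState (enc a))) ≠ 0 ↔ P a) :
    DecidableInPolyTime enc P := by
  let e' : Exp := .sub (.const 1) (.sub (.const 1) e)
  let time := 1 + (p.cost + (e'.cost + 1))
  refine ⟨.seq (.load 0 0 1) (.seq (p.compile 0) (.seq (e'.compile 0) (.copy 0 (tmpReg 0)))),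
    time, fun a => ?_⟩
  have bound_start : (startState (enc a)).bound = (enc a).getD 0 0 := rfl
  have run := (p.correct 0 (startState (enc a))).seq <|
    (e'.correct 0 (p.run (startState (enc a)))).seq <|
    Runs.copy (x := 0) (y := tmpReg 0) (l := 1) (visible_tmpReg.2 one_pos) fun _ h _ => h
  obtain ⟨r, hrun, hr⟩ := run _ ⟨rfl, fun _ _ => rfl⟩
  have output : r.reg 0 = e'.eval (p.run (startState (enc a))) := hr.reg 0 (visible_zero 1)
  refine ⟨_, r, (Exec.load _ 0 0 1).seq hrun, ?_, fun ha => ?_, fun ha => ?_⟩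
  · refine le_trans (le_of_eq ?_)
      (monotone_polynomial_eval time ((hlen a).trans (length_le_inputSize (enc a))))
    simp [time, bound_start]
  · have := (h a).2 ha
    simp only [output, e', Exp.eval]
    omega
  · have := mt (h a).1 ha
    simp only [output, e', Exp.eval]
    omega

end RAM

/-! ### The auction algorithm -/

namespace BCol.Auction

variable {α β : Type*}

/-- A stage of the auction: the owners of the items, if any, and their prices. -/
@[ext]
structure State (α β : Type*) where
  owner : β → Option α
  price : β → ℕ

/-- The bidder `u` owns no item. -/
def State.Unassigned (σ : State α β) (u : α) : Prop := ∀ s, σ.owner s ≠ some u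

/-- Among the items that the bidder `u` accepts, `s` is one of the cheapest. -/
def State.IsCheapest (E : α → β → Prop) (σ : State α β) (u : α) (s : β) : Prop :=
  E u s ∧ ∀ s', E u s' → σ.price s ≤ σ.price s'

/-- The bidder `u` takes the item `s`, whose price goes up. -/
def State.assign [DecidableEq β] (σ : State α β) (u : α) (s : β) : State α β where
  owner := Function.update σ.owner s (some u)
  price := Function.update σ.price s (σ.price s + 1)

/-- A round of the auction, which is idle if no bidder is unassigned, and may be idle if some bidder
accepts no item. -/
inductive Step [DecidableEq β] (E : α → β → Prop) (σ : State α β) : State α β → Prop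
  | assign {u : α} {s : β} (hu : σ.Unassigned u) (hs : σ.IsCheapest E u s) : Step E σ (σ.assign u s)
  | done (h : ∀ u, ¬ σ.Unassigned u) : Step E σ σ
  | stuck {u : α} (h : ∀ s, ¬ E u s) : Step E σ σ

/-- The beginning of the auction. -/
def initial : State α β := ⟨fun _ => none, fun _ => 0⟩

/-- The invariant of the auction. -/
structure Inv (E : α → β → Prop) (σ : State α β) : Prop where
  owned {s : β} : σ.price s ≠ 0 → σ.owner s ≠ none
  edge {s : β} {u : α} : σ.owner s = some u → E u s
  price_le {s s' : β} {u : α} : σ.owner s = some u → E u s' → σ.price s ≤ σ.price s' + 1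
  injective {s t : β} {u : α} : σ.owner s = some u → σ.owner t = some u → s = t

variable {E : α → β → Prop} {σ τ : State α β} {u : α}

theorem inv_initial : Inv E initial where
  owned h := absurd rfl h
  edge := nofun
  price_le := nofun
  injective := nofun

section DecidableEq

variable [DecidableEq β]

theorem Inv.assign {s : β} (h : Inv E σ) (hu : σ.Unassigned u) (hs : σ.IsCheapest E u s) :
    Inv E (σ.assign u s) := by
  have price_mono (t : β) : σ.price t ≤ (σ.assign u s).price t := by
    simp only [State.assign, Function.update_apply]
    split_ifs with ht
    · exact ht ▸ Nat.le_succ _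
    · exact le_rfl
  have owner_eq {t : β} {w : α} (ht : (σ.assign u s).owner t = some w) :
      t = s ∧ w = u ∨ t ≠ s ∧ σ.owner t = some w := by
    simp only [State.assign, Function.update_apply] at ht
    split_ifs at ht with hts
    · exact .inl ⟨hts, (Option.some_injective _ ht).symm⟩
    · exact .inr ⟨hts, ht⟩
  refine ⟨fun {t} ht => ?_, fun {t w} ht => ?_, fun {t t' w} ht hE => ?_,
    fun {t t' w} ht ht' => ?_⟩
  · simp only [State.assign, Function.update_apply] at ht ⊢
    split_ifs at ht ⊢ with hts
    · exact Option.some_ne_none u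
    · exact h.owned ht
  · obtain ⟨rfl, rfl⟩ | ⟨-, ht⟩ := owner_eq ht
    · exact hs.1
    · exact h.edge ht
  · refine le_trans ?_ (Nat.succ_le_succ (price_mono t'))
    obtain ⟨rfl, rfl⟩ | ⟨hts, ht⟩ := owner_eq ht
    · simpa [State.assign] using hs.2 t' hE
    · simpa [State.assign, hts] using h.price_le ht hE
  · obtain ⟨rfl, rfl⟩ | ⟨-, hσ⟩ := owner_eq ht <;> obtain ⟨ht's, hwu⟩ | ⟨-, hσ'⟩ := owner_eq ht'
    · exact ht's.symm
    · exact absurd hσ' (hu t')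
    · exact absurd (hwu ▸ hσ) (hu t)
    · exact h.injective hσ hσ'

theorem Inv.step (h : Inv E σ) (hστ : Step E σ τ) : Inv E τ := by
  cases hστ with
  | assign hu hs => exact h.assign hu hs
  | done => exact h
  | stuck => exact h

end DecidableEq

-- The owners of the items in `A` and the bidder `u` are more than `|A|` bidders.
theorem Inv.exists_owner_notMem [Finite β] (h : Inv E σ) {f : α → β} (hf : f.Injective)
    (hu : σ.Unassigned u) {A : Set β} (hA : ∀ s ∈ A, σ.owner s ≠ none) (huA : f u ∈ A) :
    ∃ s ∈ A, ∃ w, σ.owner s = some w ∧ f w ∉ A := by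
  by_contra! hfA
  choose g hg using fun s : A => Option.ne_none_iff_exists'.1 (hA s s.2)
  have injective : Function.Injective fun s : A => (⟨f (g s), hfA s s.2 _ (hg s)⟩ : A) :=
    fun s t hst => Subtype.ext <| h.injective (hg s) <| by
      rw [hg t, hf (Subtype.ext_iff.1 hst)]
  obtain ⟨s, hs⟩ := Finite.surjective_of_injective injective ⟨f u, huA⟩
  exact hu s ((hg s).trans (congrArg some (hf (Subtype.ext_iff.1 hs))))

theorem Inv.exists_unowned [Finite β] (h : Inv E σ) {f : α → β} (hf : f.Injective)
    (hu : σ.Unassigned u) : ∃ s, σ.owner s = none := by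
  by_contra! hall
  obtain ⟨s, -, w, -, hw⟩ := h.exists_owner_notMem hf hu (fun s _ => hall s) (Set.mem_univ (f u))
  exact hw (Set.mem_univ _)

theorem exists_pos_notMem_range [Fintype β] {p : β → ℕ} (hp : 0 ∈ Set.range p) :
    ∃ k, 0 < k ∧ k ≤ Fintype.card β ∧ k ∉ Set.range p := by
  classical
  by_contra! hrange
  have subset : Finset.range (Fintype.card β + 1) ⊆ Finset.univ.image p := fun k hk => by
    rw [Finset.mem_range, Nat.lt_succ_iff] at hk
    rw [← Finset.mem_coe, Finset.coe_image, Finset.coe_univ, Set.image_univ]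
    obtain rfl | hk' := k.eq_zero_or_pos
    · exact hp
    · exact hrange k hk' hk
  have card_le := (Finset.card_le_card subset).trans Finset.card_image_le
  rw [Finset.card_range, Finset.card_univ] at card_le
  omega

-- Some price `k` is missing, and the owners of the items above `k` accept no item below `k`.
theorem Inv.price_lt_card [Fintype β] (h : Inv E σ) {f : α → β} (hf : f.Injective)
    (hfE : ∀ w, E w (f w)) (hu : σ.Unassigned u) : σ.price (f u) < Fintype.card β := by
  by_contra! hle
  obtain ⟨s₀, hs₀⟩ := h.exists_unowned hf hu
  obtain ⟨k, k_pos, k_le, hk⟩ := exists_pos_notMem_range (p := σ.price)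
    ⟨s₀, not_not.1 fun hne => h.owned hne hs₀⟩
  obtain ⟨s, hs, w, hw, hwk⟩ := h.exists_owner_notMem hf hu (A := {s | k ≤ σ.price s})
    (fun s hs => h.owned (k_pos.trans_le hs).ne') (k_le.trans hle)
  have price_le := h.price_le hw (hfE w)
  simp only [Set.mem_ofPred_eq, not_le] at hs hwk
  exact hk ⟨s, by omega⟩

section Run

variable [DecidableEq β] {σ : ℕ → State α β}

theorem inv_of_step (h₀ : σ 0 = initial) (hσ : ∀ t, Step E (σ t) (σ (t + 1))) (t : ℕ) :
    Inv E (σ t) := by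
  induction t with
  | zero => exact h₀ ▸ inv_initial
  | succ t ih => exact ih.step (hσ t)

variable [Fintype β]

theorem price_le_card (h₀ : σ 0 = initial) (hσ : ∀ t, Step E (σ t) (σ (t + 1))) {f : α → β}
    (hf : f.Injective) (hfE : ∀ w, E w (f w)) (t : ℕ) (s : β) :
    (σ t).price s ≤ Fintype.card β := by
  induction t with
  | zero => simp [h₀, initial]
  | succ t ih =>
    generalize hτ : σ (t + 1) = τ
    have step := hτ ▸ hσ t
    cases step with
    | assign hu hs' =>
      simp only [State.assign, Function.update_apply]
      split_ifs
      · exact (hs'.2 _ (hfE _)).trans_lt ((inv_of_step h₀ hσ t).price_lt_card hf hfE hu)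
      · exact ih
    | done => exact ih
    | stuck => exact ih

theorem le_sum_price (hσ : ∀ t, Step E (σ t) (σ (t + 1)))
    (hE : ∀ w, ∃ s, E w s) (t : ℕ) (hu : (σ t).Unassigned u) : t ≤ ∑ s, (σ t).price s := by
  induction t generalizing u with
  | zero => exact Nat.zero_le _
  | succ t ih =>
    generalize hτ : σ (t + 1) = τ at hu
    have step := hτ ▸ hσ t
    cases step with
    | @assign w s hw _ =>
      have sum_eq : ∑ x, ((σ t).assign w s).price x = ∑ x, (σ t).price x + 1 := by
        simp only [State.assign, Finset.sum_update_of_mem (Finset.mem_univ s)]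
        rw [Finset.sum_eq_add_sum_sdiff_singleton_of_mem (Finset.mem_univ s) (σ t).price]
        ring
      exact sum_eq ▸ Nat.succ_le_succ (ih hw)
    | done h => exact absurd hu (h u)
    | @stuck w h => exact absurd (hE w) (not_exists.2 h)

theorem not_unassigned (h₀ : σ 0 = initial) (hσ : ∀ t, Step E (σ t) (σ (t + 1))) {f : α → β}
    (hf : f.Injective) (hfE : ∀ w, E w (f w)) {t : ℕ} (ht : Fintype.card β * Fintype.card β ≤ t) :
    ¬ (σ t).Unassigned u := fun hu => by
  have inv := inv_of_step h₀ hσ t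
  obtain ⟨s₀, hs₀⟩ := inv.exists_unowned hf hu
  have price_s₀ : (σ t).price s₀ = 0 := not_not.1 fun hne => inv.owned hne hs₀
  have sum_lt : ∑ s, (σ t).price s < ∑ _s : β, Fintype.card β :=
    Finset.sum_lt_sum (fun s _ => price_le_card h₀ hσ hf hfE t s)
      ⟨s₀, Finset.mem_univ _, price_s₀ ▸ Fintype.card_pos_iff.2 ⟨s₀⟩⟩
  have le_sum := le_sum_price hσ (fun w => ⟨f w, hfE w⟩) t hu
  rw [Finset.sum_const, Finset.card_univ, smul_eq_mul] at sum_lt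
  omega

theorem perfectlyMatchable_iff (h₀ : σ 0 = initial) (hσ : ∀ t, Step E (σ t) (σ (t + 1))) {t : ℕ}
    (ht : Fintype.card β * Fintype.card β ≤ t) :
    PerfectlyMatchable E ↔
      (∀ u, ∃ s, (σ t).owner s = some u) ∧ ∀ s, ∃ u, (σ t).owner s = some u := by
  have inv := inv_of_step h₀ hσ t
  constructor
  · rintro ⟨e, he⟩
    have assigned (u : α) : ∃ s, (σ t).owner s = some u := by
      by_contra! hu
      exact not_unassigned h₀ hσ e.injective he ht hu
    refine ⟨assigned, fun s => ?_⟩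
    choose g hg using assigned
    have g_injective : g.Injective := fun u u' huu' =>
      Option.some_injective _ (by rw [← hg u, ← hg u', huu'])
    have : Finite α := Finite.of_injective e e.injective
    obtain ⟨u, rfl⟩ := (Finite.injective_iff_surjective_of_equiv e).1 g_injective s
    exact ⟨u, hg u⟩
  · rintro ⟨assigned, owned⟩
    refine (PerfectlyMatchable.of_existsUnique (R := fun u s => (σ t).owner s = some u)
      (fun u => ?_) fun s => ?_).mono fun u s hs => inv.edge hs
    · obtain ⟨s, hs⟩ := assigned u
      exact ⟨s, hs, fun s' hs' => inv.injective hs' hs⟩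
    · obtain ⟨u, hu⟩ := owned s
      exact ⟨u, hu, fun u' hu' => Option.some_injective _ (hu'.symm.trans hu)⟩

end Run

end BCol.Auction

/-! ### Formulas and bounded search -/

namespace RAM

theorem State.var_setVar_of_ne {s : State} {x y n : ℕ} (h : y ≠ x) :
    (s.setVar x n).var y = s.var y := by
  rw [State.var_setVar, if_neg h]

namespace Exp

/-- Expressions as formulas: an expression holds in a state if its value there is not zero. -/
def Holds (e : Exp) (s : State) : Prop := e.eval s ≠ 0

/-- Negation. -/
def neg (e : Exp) : Exp := .sub (.const 1) e

/-- Conjunction. -/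
def conj (e f : Exp) : Exp := .neg (.add (.neg e) (.neg f))

/-- Implication. -/
def imp (e f : Exp) : Exp := .add (.neg e) f

/-- Bounded universal quantification. Bounded existential quantification is `Exp.sum`. -/
def all (x : ℕ) (e : Exp) : Exp := .neg (.sum x (.neg e))

/-- The order relation. -/
def le (e f : Exp) : Exp := .neg (.sub e f)

/-- Equality. -/
def eq (e f : Exp) : Exp := .conj (.le e f) (.le f e)

/-- The least value of `x` for which `e` holds, or the bound if there is none: it is the number of
`y` such that `e` fails for all `x ≤ y`. Here `y` is the variable `x + 1`, which `e` may use as a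
bound variable only. -/
def find (x : ℕ) (e : Exp) : Exp :=
  .sum (x + 1) (.neg (.sum x (.conj (.le (.var x) (.var (x + 1))) e)))

variable {e f : Exp} {s : State} {x n : ℕ}

@[simp]
theorem holds_neg : (neg e).Holds s ↔ ¬ e.Holds s := by
  simp only [Holds, neg, eval]
  omega

@[simp]
theorem holds_add : (add e f).Holds s ↔ e.Holds s ∨ f.Holds s := by
  simp only [Holds, eval]
  omega

@[simp]
theorem holds_conj : (conj e f).Holds s ↔ e.Holds s ∧ f.Holds s := by
  simp only [conj, holds_neg, holds_add]
  tauto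

@[simp]
theorem holds_imp : (imp e f).Holds s ↔ (e.Holds s → f.Holds s) := by
  simp only [imp, holds_neg, holds_add]
  tauto

@[simp]
theorem holds_le : (le e f).Holds s ↔ e.eval s ≤ f.eval s := by
  simp only [Holds, le, neg, eval]
  omega

@[simp]
theorem holds_eq : (eq e f).Holds s ↔ e.eval s = f.eval s := by
  simp only [eq, holds_conj, holds_le]
  omega

theorem holds_sum (hn : s.bound = n) :
    (sum x e).Holds s ↔ ∃ i : Fin n, e.Holds (s.setVar x i) := by
  simp [Holds, eval, hn, Finset.sum_eq_zero_iff, Fin.exists_iff]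

theorem holds_all (hn : s.bound = n) :
    (all x e).Holds s ↔ ∀ i : Fin n, e.Holds (s.setVar x i) := by
  simp [all, holds_sum hn]

theorem eval_neg [Decidable (e.Holds s)] : (neg e).eval s = if e.Holds s then 0 else 1 := by
  split_ifs with h <;> simp only [Holds, neg, eval] at h ⊢ <;> omega

theorem eval_find_eq {Q : Fin n → Prop} (hn : s.bound = n)
    (hQ : ∀ (i : Fin n) (j : ℕ), e.Holds ((s.setVar (x + 1) j).setVar x i) ↔ Q i) {m : ℕ}
    (hmn : m ≤ n) (hm : ∀ j < n, (∃ i : Fin n, i ≤ j ∧ Q i) ↔ m ≤ j) : (find x e).eval s = m := by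
  classical
  have term_eq (j : ℕ) (hj : j < n) : (neg (.sum x (.conj (.le (.var x) (.var (x + 1))) e))).eval
      (s.setVar (x + 1) j) = if j < m then 1 else 0 := by
    have holds_iff : (Exp.sum x (.conj (.le (.var x) (.var (x + 1))) e)).Holds
        (s.setVar (x + 1) j) ↔ m ≤ j := by
      rw [holds_sum ((State.bound_setVar ..).trans hn), ← hm j hj]
      refine exists_congr fun i => ?_
      simp [eval, hQ, State.var_setVar]
    rw [eval_neg, if_congr holds_iff rfl rfl]
    split_ifs <;> omega
  rw [find, eval, hn, Finset.sum_congr rfl fun j hj => term_eq j (Finset.mem_range.1 hj),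
    Finset.sum_boole, Finset.range_eq_Ico, Finset.Ico_filter_lt, min_eq_right hmn, Nat.card_Ico,
    Nat.sub_zero, Nat.cast_id]

theorem eval_find {Q : Fin n → Prop} (hn : s.bound = n)
    (hQ : ∀ (i : Fin n) (j : ℕ), e.Holds ((s.setVar (x + 1) j).setVar x i) ↔ Q i) :
    (∃ i, Q i ∧ (find x e).eval s = i) ∨ (∀ i, ¬ Q i) ∧ (find x e).eval s = n := by
  by_cases hex : ∃ i, Q i
  · obtain ⟨i, hi, hmin⟩ := WellFounded.has_min (wellFounded_lt (α := Fin n)) {i | Q i} hex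
    refine .inl ⟨i, hi, eval_find_eq hn hQ i.2.le fun j _ => ⟨?_, fun hij => ⟨i, hij, hi⟩⟩⟩
    rintro ⟨i', hi'j, hi'⟩
    exact (Fin.val_le_of_le (not_lt.1 (hmin i' hi'))).trans hi'j
  · refine .inr ⟨not_exists.1 hex, eval_find_eq hn hQ le_rfl fun j hj => ⟨?_, fun hnj => ?_⟩⟩
    · rintro ⟨i, -, hi⟩
      exact absurd ⟨i, hi⟩ hex
    · omega

end Exp

end RAM

/-! ### Reading the input -/

namespace BCol

open RAM

theorem getD_flatMap {α : Type*} {m : ℕ} {f : α → List ℕ} (hf : ∀ a, (f a).length = m)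
    {l : List α} {i j : ℕ} (hi : i < l.length) (hj : j < m) :
    (l.flatMap f).getD (m * i + j) 0 = (f l[i]).getD j 0 := by
  induction l generalizing i with
  | nil => simp at hi
  | cons a l ih =>
    rw [List.flatMap_cons]
    cases i with
    | zero =>
      rw [List.getD_append _ _ _ _ (by rw [hf]; omega)]
      simp
    | succ i =>
      rw [List.getD_append_right _ _ _ _ (by rw [hf]; nlinarith), hf,
        show m * (i + 1) + j - m = m * i + j by rw [Nat.mul_succ]; omega,
        ih (by simpa using hi)]
      simp

theorem getD_map_finRange {n : ℕ} (f : Fin n → ℕ) (v : Fin n) :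
    ((List.finRange n).map f).getD v 0 = f v := by
  rw [List.getD_eq_getElem _ _ (by simp)]
  simp

theorem length_matrix {n : ℕ} (f : Fin n → Fin n → ℕ) :
    ((List.finRange n).flatMap fun i => (List.finRange n).map (f i)).length = n * n := by
  simp [List.length_flatMap]

theorem getD_matrix {n : ℕ} (f : Fin n → Fin n → ℕ) (i j : Fin n) :
    ((List.finRange n).flatMap fun i => (List.finRange n).map (f i)).getD (n * i + j) 0 =
      f i j := by
  rw [getD_flatMap (by simp) (by simp) j.2, getD_map_finRange]
  simp

namespace Instance

variable (I : Instance)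

theorem length_encode : I.encode.length = 1 + I.n * I.n + I.n + I.n := by
  classical
  simp only [encode, List.length_append, length_matrix, List.length_map, List.length_finRange,
    List.length_singleton]

theorem getD_encode_zero : I.encode.getD 0 0 = I.n := by
  simp [encode]

open Classical in
theorem getD_encode_adj (x y : Fin I.n) :
    I.encode.getD (1 + I.n * x + y) 0 = if I.G.Adj x y then 1 else 0 := by
  have lt : I.n * x + y < I.n * I.n := by
    have := Nat.mul_le_mul_left I.n (Nat.succ_le_of_lt x.2)
    rw [Nat.mul_succ] at this
    omega
  unfold encode
  rw [List.getD_append, List.getD_append, List.getD_append_right, List.length_singleton,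
    show 1 + I.n * x + y - 1 = I.n * x + y by omega, getD_matrix]
  all_goals
    simp only [List.length_append, length_matrix, List.length_singleton, List.length_map,
      List.length_finRange]
    omega

open Classical in
theorem getD_encode_mem (x : Fin I.n) :
    I.encode.getD (1 + I.n * I.n + x) 0 = if x ∈ I.S' then 1 else 0 := by
  unfold encode
  rw [List.getD_append, List.getD_append_right, List.length_append, length_matrix,
    List.length_singleton, Nat.add_sub_cancel_left, getD_map_finRange]
  all_goals
    simp only [List.length_append, length_matrix, List.length_singleton, List.length_map,
      List.length_finRange]
    omega

open Classical in
theorem getD_encode_colour (x : Fin I.n) :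
    I.encode.getD (1 + I.n * I.n + I.n + x) 0 =
      if h : x ∈ I.S' ∪ denseSet I.G then (I.c' ⟨x, h⟩ : ℕ) else 0 := by
  have length_eq : ([I.n] ++ (List.finRange I.n).flatMap
      (fun i => (List.finRange I.n).map fun j => if I.G.Adj i j then 1 else 0) ++
      (List.finRange I.n).map fun v => if v ∈ I.S' then 1 else 0).length =
      1 + I.n * I.n + I.n := by
    simp only [List.length_append, length_matrix, List.length_singleton, List.length_map,
      List.length_finRange]
  unfold encode
  rw [List.getD_append_right _ _ _ _ (by omega), length_eq, Nat.add_sub_cancel_left,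
    getD_map_finRange]

end Instance

/-- The loop bound is the number of vertices of `I`, and the array `0` holds the encoding of `I`. -/
structure Reads (I : Instance) (s : State) : Prop where
  bound : s.bound = I.n
  input (i : ℕ) : s.arr 0 i = I.encode.getD i 0

theorem reads_startState (I : Instance) : Reads I (startState I.encode) :=
  ⟨I.getD_encode_zero, fun _ => rfl⟩

variable {I : Instance} {s : State}

theorem Reads.setVar (hs : Reads I s) (x n : ℕ) : Reads I (s.setVar x n) :=
  ⟨(State.bound_setVar ..).trans hs.bound, hs.input⟩

theorem Reads.setArr (hs : Reads I s) {a : ℕ} (ha : 0 ≠ a) (i n : ℕ) : Reads I (s.setArr a i n) :=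
  ⟨hs.bound, fun j => by rw [State.arr_setArr, if_neg (fun h => ha h.1), hs.input]⟩

/-! ### The formulas that describe the auxiliary graph -/

namespace Formula

/-- Adjacency of the vertices `a` and `b`. There being no multiplication, the offset of the row of
`a` in the adjacency matrix is a sum. -/
def adj (a b : ℕ) : Exp := .arr 0 (.add (.add (.const 1) (.sum (a + 1) (.var a))) (.var b))

/-- Membership in `S'`. -/
def memS' (a : ℕ) : Exp := .arr 0 (.add (.add (.const 1) (.sum 0 .bound)) (.var a))

/-- The colour of a vertex, or `0`. -/
def colour (a : ℕ) : Exp :=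
  .arr 0 (.add (.add (.add (.const 1) (.sum 0 .bound)) .bound) (.var a))

/-- Membership in the set of dense vertices, which are the coloured vertices outside `S'`. -/
def dense (a : ℕ) : Exp := .conj (colour a) (.neg (memS' a))

/-- Membership in `T₁`. -/
def memT₁ (a : ℕ) : Exp :=
  .conj (dense a) <| .all (a + 1) <| .imp (dense (a + 1)) <|
    .imp (.neg (.eq (.var (a + 1)) (.var a))) (adj (a + 1) a)

/-- Membership in `T'`. -/
def memT' (a : ℕ) : Exp :=
  .conj (dense a) <| .sum (a + 1) <| .conj (memS' (a + 1)) (.eq (colour a) (colour (a + 1)))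

/-- Membership in `T₂`. -/
def memT₂ (a : ℕ) : Exp := .conj (dense a) (.neg (.add (memT₁ a) (memT' a)))

/-- Membership in `freeBoundary`. -/
def memFree (a : ℕ) : Exp :=
  .conj (.conj (.sum (a + 1) (.conj (dense (a + 1)) (adj (a + 1) a))) (.neg (dense a)))
    (.neg (memS' a))

/-- The relation `AuxAdj`. -/
def auxAdj (a b : ℕ) : Exp :=
  .conj (.neg (adj a b)) <| .all (a + b + 1) <|
    .imp (.conj (.add (memT₂ (a + b + 1)) (memT' (a + b + 1)))
      (.neg (.eq (.var (a + b + 1)) (.var a))))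
    (.neg (.conj (adj a (a + b + 1)) (adj b (a + b + 1))))

/-- The condition `ColoursUsedOnDense`. -/
def coloursUsed : Exp :=
  .all 0 <| .imp (memS' 0) <| .sum 1 <| .conj (dense 1) (.eq (colour 1) (colour 0))

variable {a b : ℕ} {x y : Fin I.n}

theorem holds_adj (hs : Reads I s) (ha : s.var a = x) (hb : s.var b = y) :
    (adj a b).Holds s ↔ I.G.Adj x y := by
  classical
  rw [Exp.Holds, show (adj a b).eval s = if I.G.Adj x y then 1 else 0 by
    simp only [adj, Exp.eval, State.var_setVar_of_ne a.succ_ne_self.symm, Finset.sum_const,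
      Finset.card_range, smul_eq_mul, hs.input, hs.bound, ha, hb, I.getD_encode_adj]]
  split_ifs with h <;> simp [h]

theorem holds_memS' (hs : Reads I s) (ha : s.var a = x) : (memS' a).Holds s ↔ x ∈ I.S' := by
  classical
  rw [Exp.Holds, show (memS' a).eval s = if x ∈ I.S' then 1 else 0 by
    simp only [memS', Exp.eval, State.bound_setVar, Finset.sum_const, Finset.card_range,
      smul_eq_mul, hs.input, hs.bound, ha, I.getD_encode_mem]]
  split_ifs with h <;> simp [h]

open Classical in
theorem eval_colour (hs : Reads I s) (ha : s.var a = x) : (colour a).eval s =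
    if h : x ∈ I.S' ∪ denseSet I.G then (I.c' ⟨x, h⟩ : ℕ) else 0 := by
  simp only [colour, Exp.eval, State.bound_setVar, Finset.sum_const, Finset.card_range,
    smul_eq_mul, hs.input, hs.bound, ha, I.getD_encode_colour]

theorem holds_eq_colour (hs : Reads I s) {x y : ↥(I.S' ∪ denseSet I.G)}
    (ha : s.var a = (x : Fin I.n)) (hb : s.var b = (y : Fin I.n)) :
    (Exp.eq (colour a) (colour b)).Holds s ↔ I.c' x = I.c' y := by
  rw [Exp.holds_eq, eval_colour hs ha, eval_colour hs hb, dif_pos x.2, dif_pos y.2, PNat.coe_inj]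

theorem holds_dense (hs : Reads I s) (ha : s.var a = x) :
    (dense a).Holds s ↔ x ∈ denseSet I.G := by
  rw [dense, Exp.holds_conj, Exp.holds_neg, holds_memS' hs ha, Exp.Holds, eval_colour hs ha]
  by_cases hx : x ∈ I.S' ∪ denseSet I.G
  · rw [dif_pos hx]
    exact ⟨fun h => hx.resolve_left h.2, fun h => ⟨PNat.ne_zero _, fun h' =>
      (I.subset_boundary h').2 h⟩⟩
  · rw [dif_neg hx]
    exact ⟨fun h => absurd rfl h.1, fun h => absurd (Or.inr h) hx⟩

theorem holds_memT₁ (hs : Reads I s) (ha : s.var a = x) :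
    (memT₁ a).Holds s ↔ x ∈ T₁ I.G := by
  simp only [memT₁, Exp.holds_conj, Exp.holds_all hs.bound, Exp.holds_imp, Exp.holds_neg,
    Exp.holds_eq, Exp.eval, holds_dense hs ha]
  refine and_congr_right fun _ => forall_congr' fun w => ?_
  have hw := s.var_setVar_self (a + 1) w
  have ha' := (State.var_setVar_of_ne (n := w) a.succ_ne_self.symm).trans ha
  rw [holds_dense (hs.setVar ..) hw, holds_adj (hs.setVar ..) hw ha', hw, ha', Fin.val_inj]

theorem holds_memT' (hs : Reads I s) (ha : s.var a = x) :
    (memT' a).Holds s ↔ x ∈ T' I.G I.S' I.c' := by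
  simp only [memT', Exp.holds_conj, Exp.holds_sum hs.bound, holds_dense hs ha]
  have hw (w : Fin I.n) := s.var_setVar_self (a + 1) w
  have ha' (w : Fin I.n) := (State.var_setVar_of_ne (n := w) a.succ_ne_self.symm).trans ha
  simp only [fun w : Fin I.n => holds_memS' (hs.setVar (a + 1) w) (hw w)]
  constructor
  · rintro ⟨hx, w, hw', h⟩
    exact ⟨⟨x, .inr hx⟩, ⟨w, .inl hw'⟩, rfl, hx, hw',
      (holds_eq_colour (hs.setVar ..) (ha' w) (hw w)).1 h⟩
  · rintro ⟨u, w, rfl, hx, hw', h⟩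
    exact ⟨hx, w, hw', (holds_eq_colour (hs.setVar ..) (ha' w) (hw w)).2 h⟩

theorem holds_memT₂ (hs : Reads I s) (ha : s.var a = x) :
    (memT₂ a).Holds s ↔ x ∈ T₂ I.G I.S' I.c' := by
  rw [memT₂, Exp.holds_conj, Exp.holds_neg, Exp.holds_add, holds_dense hs ha, holds_memT₁ hs ha,
    holds_memT' hs ha]
  rfl

theorem holds_memFree (hs : Reads I s) (ha : s.var a = x) :
    (memFree a).Holds s ↔ x ∈ freeBoundary I.G I.S' := by
  simp only [memFree, Exp.holds_conj, Exp.holds_neg, Exp.holds_sum hs.bound, holds_dense hs ha,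
    holds_memS' hs ha, outerBoundary, Set.mem_sdiff, Set.mem_iUnion, SimpleGraph.mem_neighborSet,
    exists_prop]
  refine and_congr_left fun _ => and_congr_left fun _ => exists_congr fun w => ?_
  have hw := s.var_setVar_self (a + 1) w
  rw [holds_dense (hs.setVar ..) hw, holds_adj (hs.setVar ..) hw
    ((State.var_setVar_of_ne a.succ_ne_self.symm).trans ha)]

theorem holds_auxAdj (hs : Reads I s) (ha : s.var a = x) (hb : s.var b = y) :
    (auxAdj a b).Holds s ↔ AuxAdj I.G I.S' I.c' x y := by
  simp only [auxAdj, Exp.holds_conj, Exp.holds_all hs.bound, Exp.holds_imp, Exp.holds_neg,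
    Exp.holds_add, Exp.holds_eq, Exp.eval, holds_adj hs ha hb]
  refine and_congr_right fun _ => forall_congr' fun w => ?_
  have hs' := hs.setVar (a + b + 1) w
  have hw := s.var_setVar_self (a + b + 1) w
  have ha' := (State.var_setVar_of_ne (n := w) (show a ≠ a + b + 1 by omega)).trans ha
  have hb' := (State.var_setVar_of_ne (n := w) (show b ≠ a + b + 1 by omega)).trans hb
  rw [holds_memT₂ hs' hw, holds_memT' hs' hw, holds_adj hs' ha' hw, holds_adj hs' hb' hw, hw, ha',
    Fin.val_inj]
  rfl

theorem holds_coloursUsed (hs : Reads I s) : coloursUsed.Holds s ↔ ColoursUsedOnDense I.c' := by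
  simp only [coloursUsed, Exp.holds_all hs.bound, Exp.holds_imp,
    fun v : Fin I.n => holds_memS' (hs.setVar 0 v) (s.var_setVar_self 0 v)]
  have hs' (v w : Fin I.n) := (hs.setVar 0 v).setVar 1 w
  have hw (v w : Fin I.n) := (s.setVar 0 v).var_setVar_self 1 w
  have hv (v w : Fin I.n) :=
    (State.var_setVar_of_ne (n := w) zero_ne_one).trans (s.var_setVar_self 0 v)
  constructor
  · intro h v hvS
    obtain ⟨u, hu⟩ := (Exp.holds_sum (hs.setVar ..).bound).1 (h v hvS)
    rw [Exp.holds_conj, holds_dense (hs' v u) (hw v u)] at hu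
    obtain ⟨hu, huc⟩ := hu
    exact ⟨⟨u, .inr hu⟩, hu, (holds_eq_colour (hs' v u) (hw v u) (hv v u)).1 huc⟩
  · intro h v hvS
    obtain ⟨u, hu, huc⟩ := h ⟨v, .inl hvS⟩ hvS
    refine (Exp.holds_sum (hs.setVar ..).bound).2 ⟨u, Exp.holds_conj.2 ⟨?_, ?_⟩⟩
    · exact (holds_dense (hs' v u) (hw v u)).2 hu
    · exact (holds_eq_colour (hs' v u) (y := ⟨v, .inl hvS⟩) (hw v u) (hv v u)).2 huc

end Formula

/-! ### The decision procedure -/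

namespace Procedure

/-- The bidder in variable `0` owns no item. The array `1` holds the owners of the items, numbered
from one, so that an entry `0` means that there is none. -/
def unassigned : Exp :=
  .conj (Formula.memT₂ 0) <| .all 1 <| .imp (Formula.memFree 1) <|
    .neg (.eq (.arr 1 (.var 1)) (.add (.var 0) (.const 1)))

/-- The item in variable `1` is one of the cheapest for the bidder in variable `0`, which is a
vertex. The array `2` holds the prices of the items. -/
def cheapest : Exp :=
  .conj (.sub .bound (.var 0)) <| .conj (Formula.memFree 1) <| .conj (Formula.auxAdj 0 1) <|
    .all 2 <| .imp (Formula.memFree 2) <| .imp (Formula.auxAdj 0 2) <|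
      .le (.arr 2 (.var 1)) (.arr 2 (.var 2))

/-- One round of the auction. If no bidder is unassigned, or the first one accepts no item, then the
variable `1` receives the number of vertices, and cells that represent no item are written. -/
def round : Stmt :=
  .seq (.assign 0 (.find 0 unassigned)) <| .seq (.assign 1 (.find 1 cheapest)) <|
    .seq (.store 1 (.var 1) (.add (.var 0) (.const 1))) <|
      .store 2 (.var 1) (.add (.arr 2 (.var 1)) (.const 1))

/-- The auction. -/
def auction : Stmt := .rep (.rep round)

/-- The final test: the colours on `S'` are used on dense vertices, every bidder owns an item, and
every item is owned. -/
def accepts : Exp :=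
  .conj Formula.coloursUsed <| .conj
    (.all 0 <| .imp (Formula.memT₂ 0) <| .sum 1 <| .conj (Formula.memFree 1) <|
      .eq (.arr 1 (.var 1)) (.add (.var 0) (.const 1)))
    (.all 1 <| .imp (Formula.memFree 1) <| .sum 0 <| .conj (Formula.memT₂ 0) <|
      .eq (.arr 1 (.var 1)) (.add (.var 0) (.const 1)))

/-- The bidders are the vertices in `T₂`. -/
abbrev Bidder (I : Instance) : Type := T₂ I.G I.S' I.c'

/-- The items are the vertices in `freeBoundary`. -/
abbrev Item (I : Instance) : Type := freeBoundary I.G I.S'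

/-- The bidder `u` accepts the item `t`. -/
def Edge (I : Instance) (u : Bidder I) (t : Item I) : Prop := AuxAdj I.G I.S' I.c' u t

open Classical in
/-- The stage of the auction that the arrays `1` and `2` represent. -/
noncomputable def auctionState (I : Instance) (s : State) : Auction.State (Bidder I) (Item I) where
  owner t := if h : ∃ u : Bidder I, s.arr 1 t = (u : Fin I.n) + 1 then some h.choose else none
  price t := s.arr 2 t

/-- The bidder `u` is entered as the owner of the item `t`, and the price of `t` goes up. -/
def record (s : State) (u t : ℕ) : State := (s.setArr 1 t (u + 1)).setArr 2 t (s.arr 2 t + 1)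

theorem owner_auctionState_eq_some {u : Bidder I} {t : Item I} :
    (auctionState I s).owner t = some u ↔ s.arr 1 t = (u : Fin I.n) + 1 := by
  constructor
  · intro h
    simp only [auctionState] at h
    split_ifs at h with hex
    exact Option.some_injective _ h ▸ hex.choose_spec
  · intro h
    have hex : ∃ u : Bidder I, s.arr 1 t = (u : Fin I.n) + 1 := ⟨u, h⟩
    have choose_eq : hex.choose = u :=
      Subtype.ext (Fin.ext (Nat.succ_injective (hex.choose_spec.symm.trans h)))
    exact (dif_pos hex).trans (congrArg some choose_eq)

theorem auctionState_record (u : Bidder I) (t : Item I) :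
    auctionState I (record s (u : Fin I.n) (t : Fin I.n)) = (auctionState I s).assign u t := by
  have val_eq_iff (t' : Item I) : ((t' : Fin I.n) : ℕ) = (t : Fin I.n) ↔ t' = t := by
    rw [Fin.val_inj, Subtype.coe_inj]
  ext t' u'
  · rw [owner_auctionState_eq_some]
    by_cases ht : t' = t
    · simp [record, State.arr_setArr, Auction.State.assign, ht, Fin.val_inj, Subtype.coe_inj]
    · simp [record, State.arr_setArr, Auction.State.assign, ht, val_eq_iff,
        owner_auctionState_eq_some]
  · simp [auctionState, record, State.arr_setArr, Auction.State.assign, Function.update_apply,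
      val_eq_iff]

theorem auctionState_record_bound (u : ℕ) :
    auctionState I (record s u I.n) = auctionState I s := by
  have ne (t : Item I) : ((t : Fin I.n) : ℕ) ≠ I.n := (t : Fin I.n).2.ne
  ext t u'
  · simp [owner_auctionState_eq_some, record, State.arr_setArr, ne]
  · simp [auctionState, record, State.arr_setArr, ne]

theorem run_round {u t : ℕ} (hu : (Exp.find 0 unassigned).eval s = u)
    (ht : (Exp.find 1 cheapest).eval (s.setVar 0 u) = t) :
    round.run s = record ((s.setVar 0 u).setVar 1 t) u t := by
  simp [round, Stmt.run, Exp.eval, hu, ht, record, State.var_setVar, State.arr_setArr]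

theorem holds_unassigned (hs : Reads I s) {x : Fin I.n} (hx : s.var 0 = x) :
    unassigned.Holds s ↔ ∃ h : x ∈ T₂ I.G I.S' I.c', (auctionState I s).Unassigned ⟨x, h⟩ := by
  simp only [unassigned, Exp.holds_conj, Exp.holds_all hs.bound, Exp.holds_imp, Exp.holds_neg,
    Exp.holds_eq, Exp.eval, Formula.holds_memT₂ hs hx, Auction.State.Unassigned,
    owner_auctionState_eq_some, Subtype.forall, exists_prop,
    fun t : Fin I.n => Formula.holds_memFree (hs.setVar 1 t) (s.var_setVar_self 1 t),
    State.var_setVar_self, State.var_setVar_of_ne zero_ne_one, State.arr_setVar, hx, ne_eq]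

theorem holds_cheapest (hs : Reads I s) {u : Bidder I} {t : Fin I.n}
    (hu : s.var 0 = (u : Fin I.n)) (ht : s.var 1 = t) :
    cheapest.Holds s ↔ ∃ h : t ∈ freeBoundary I.G I.S',
      (auctionState I s).IsCheapest (Edge I) u ⟨t, h⟩ := by
  have guard : (Exp.sub .bound (.var 0)).Holds s := by
    simp only [Exp.Holds, Exp.eval, hu, hs.bound]
    omega
  have hs' (t' : Fin I.n) := hs.setVar 2 t'
  have ht' (t' : Fin I.n) := s.var_setVar_self 2 t'
  have hu' (t' : Fin I.n) := (State.var_setVar_of_ne (n := t') (show 0 ≠ 2 by decide)).trans hu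
  simp only [cheapest, Exp.holds_conj, Exp.holds_all hs.bound, Exp.holds_imp, Exp.holds_le,
    Exp.eval, guard, true_and, Formula.holds_memFree hs ht, Formula.holds_auxAdj hs hu ht,
    fun t' => Formula.holds_memFree (hs' t') (ht' t'),
    fun t' => Formula.holds_auxAdj (hs' t') (hu' t') (ht' t'),
    State.var_setVar_self, State.var_setVar_of_ne (show 1 ≠ 2 by decide), State.arr_setVar, ht,
    Auction.State.IsCheapest, Edge, auctionState, Subtype.forall, exists_prop]

theorem find_unassigned (hs : Reads I s) :
    (∃ u : Bidder I, (auctionState I s).Unassigned u ∧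
      (Exp.find 0 unassigned).eval s = (u : Fin I.n)) ∨
    (∀ u, ¬ (auctionState I s).Unassigned u) ∧ (Exp.find 0 unassigned).eval s = I.n := by
  have holds_iff (i : Fin I.n) (j : ℕ) : unassigned.Holds ((s.setVar 1 j).setVar 0 i) ↔
      ∃ hi : i ∈ T₂ I.G I.S' I.c', (auctionState I s).Unassigned ⟨i, hi⟩ :=
    holds_unassigned ((hs.setVar 1 j).setVar 0 i) (State.var_setVar_self ..)
  obtain ⟨i, ⟨hi, hu⟩, eval_eq⟩ | ⟨h, eval_eq⟩ := Exp.eval_find hs.bound holds_iff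
  · exact .inl ⟨⟨i, hi⟩, hu, eval_eq⟩
  · exact .inr ⟨fun u hu => h u ⟨u.2, hu⟩, eval_eq⟩

theorem find_cheapest (hs : Reads I s) {u : Bidder I} (hu : s.var 0 = (u : Fin I.n)) :
    (∃ t : Item I, (auctionState I s).IsCheapest (Edge I) u t ∧
      (Exp.find 1 cheapest).eval s = (t : Fin I.n)) ∨
    (∀ t, ¬ (auctionState I s).IsCheapest (Edge I) u t) ∧
      (Exp.find 1 cheapest).eval s = I.n := by
  have holds_iff (i : Fin I.n) (j : ℕ) : cheapest.Holds ((s.setVar 2 j).setVar 1 i) ↔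
      ∃ hi : i ∈ freeBoundary I.G I.S', (auctionState I s).IsCheapest (Edge I) u ⟨i, hi⟩ :=
    holds_cheapest ((hs.setVar 2 j).setVar 1 i) (by simpa [State.var_setVar] using hu)
      (State.var_setVar_self ..)
  obtain ⟨i, ⟨hi, ht⟩, eval_eq⟩ | ⟨h, eval_eq⟩ := Exp.eval_find hs.bound holds_iff
  · exact .inl ⟨⟨i, hi⟩, ht, eval_eq⟩
  · exact .inr ⟨fun t ht => h t ⟨t.2, ht⟩, eval_eq⟩

theorem find_cheapest_of_var_eq_bound (hs : Reads I s) (hu : s.var 0 = I.n) :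
    (Exp.find 1 cheapest).eval s = I.n := by
  have not_holds (i : Fin I.n) (j : ℕ) :
      cheapest.Holds ((s.setVar (1 + 1) j).setVar 1 i) ↔ False := by
    simp [cheapest, Exp.Holds, Exp.conj, Exp.neg, Exp.eval, State.var_setVar, hs.bound, hu]
  obtain ⟨_, h, -⟩ | ⟨-, eval_eq⟩ := Exp.eval_find hs.bound not_holds
  · exact h.elim
  · exact eval_eq

theorem step_run_round (hs : Reads I s) :
    Auction.Step (Edge I) (auctionState I s) (auctionState I (round.run s)) := by
  obtain ⟨u, hu, u_eq⟩ | ⟨done, u_eq⟩ := find_unassigned hs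
  · obtain ⟨t, ht, t_eq⟩ | ⟨none_cheapest, t_eq⟩ :=
      find_cheapest (hs.setVar 0 (u : Fin I.n)) (s.var_setVar_self 0 (u : Fin I.n))
    · rw [run_round u_eq t_eq, auctionState_record]
      exact .assign hu ht
    · rw [run_round u_eq t_eq, auctionState_record_bound]
      refine .stuck (u := u) fun t htE => ?_
      obtain ⟨t, ht, hmin⟩ := Set.exists_min_image {t | Edge I u t} (auctionState I s).price
        (Set.toFinite _) ⟨t, htE⟩
      exact none_cheapest t ⟨ht, hmin⟩
  · have t_eq := find_cheapest_of_var_eq_bound (hs.setVar 0 I.n) (s.var_setVar_self 0 I.n)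
    rw [run_round u_eq t_eq, auctionState_record_bound]
    exact .done done

theorem reads_run_round (hs : Reads I s) : Reads I (round.run s) :=
  (((hs.setVar 0 _).setVar 1 _).setArr zero_ne_one _ _).setArr (by decide) _ _

theorem run_auction : auction.run s = round.run^[s.bound * s.bound] s := by
  have iterate (m : ℕ) : (Stmt.rep round).run^[m] s = round.run^[s.bound * m] s := by
    induction m with
    | zero => rfl
    | succ m ih =>
      rw [Function.iterate_succ_apply', ih, Nat.mul_succ, Nat.add_comm,
        Function.iterate_add_apply, Stmt.run, Stmt.bound_iterate_run]
  exact iterate s.bound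

theorem auctionState_startState : auctionState I (startState I.encode) = Auction.initial := by
  ext t u
  · simp [owner_auctionState_eq_some, Auction.initial, startState, initState]
  · simp [auctionState, Auction.initial, startState, initState]

theorem holds_accepts (hs : Reads I s) :
    accepts.Holds s ↔ ColoursUsedOnDense I.c' ∧
      (∀ u, ∃ t, (auctionState I s).owner t = some u) ∧
      ∀ t, ∃ u, (auctionState I s).owner t = some u := by
  simp only [accepts, Exp.holds_conj, Formula.holds_coloursUsed hs, Exp.holds_all hs.bound,
    Exp.holds_imp, Exp.holds_eq, Exp.eval, Exp.holds_sum (State.bound_setVar .. |>.trans hs.bound),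
    fun u : Fin I.n => Formula.holds_memT₂ (hs.setVar 0 u) (s.var_setVar_self 0 u),
    fun t : Fin I.n => Formula.holds_memFree (hs.setVar 1 t) (s.var_setVar_self 1 t),
    fun u t : Fin I.n => Formula.holds_memFree ((hs.setVar 0 u).setVar 1 t)
      (State.var_setVar_self ..),
    fun t u : Fin I.n => Formula.holds_memT₂ ((hs.setVar 1 t).setVar 0 u)
      (State.var_setVar_self ..),
    State.var_setVar_self, State.var_setVar_of_ne zero_ne_one, State.var_setVar_of_ne one_ne_zero,
    State.arr_setVar, Subtype.forall, Subtype.exists, owner_auctionState_eq_some, exists_prop]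

theorem holds_accepts_run :
    accepts.Holds (auction.run (startState I.encode)) ↔ I.HasExtension := by
  classical
  have reads (t : ℕ) : Reads I (round.run^[t] (startState I.encode)) := by
    induction t with
    | zero => exact reads_startState I
    | succ t ih =>
      rw [Function.iterate_succ_apply']
      exact reads_run_round ih
  have step (t : ℕ) : Auction.Step (Edge I) (auctionState I (round.run^[t] (startState I.encode)))
      (auctionState I (round.run^[t + 1] (startState I.encode))) := by
    rw [Function.iterate_succ_apply']
    exact step_run_round (reads t)
  have card_le : Fintype.card (Item I) ≤ I.n := by
    exact (Fintype.card_subtype_le _).trans_eq (Fintype.card_fin I.n)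
  rw [run_auction, holds_accepts (reads _), (reads_startState I).bound,
    ← Auction.perfectlyMatchable_iff (E := Edge I)
      (σ := fun t => auctionState I (round.run^[t] (startState I.encode)))
      auctionState_startState step (Nat.mul_le_mul card_le card_le)]
  exact (hasBPrecolouringExtension_iff I.isTight I.subset_boundary I.isPartial).symm

end Procedure

theorem decidableInPolyTime_hasExtension :
    DecidableInPolyTime Instance.encode Instance.HasExtension := by
  refine .of_stmt Procedure.auction Procedure.accepts (fun I => ?_)
    fun I => Procedure.holds_accepts_run
  rw [I.getD_encode_zero, I.length_encode]
  omega

end BCol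

theorem mainTheorem4 :
    RAM.DecidableInPolyTime BCol.Instance.encode BCol.Instance.HasExtension ∧
    ∀ {V : Type*} [Finite V] (G : SimpleGraph V) (S' : Set V) (c' : BCol.PreColouring G S'),
      BCol.IsTight G → S' ⊆ BCol.outerBoundary G (BCol.denseSet G) →
      BCol.IsPartialBColouring G S' c' →
      (BCol.HasBPrecolouringExtension G S' c' ↔
        (∀ s : ↥(S' ∪ BCol.denseSet G), (s : V) ∈ S' →
          ∃ u : ↥(S' ∪ BCol.denseSet G), (u : V) ∈ BCol.denseSet G ∧ c' u = c' s) ∧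
        ∃ M : (BCol.auxGraph G S' c').Subgraph, M.IsPerfectMatching) := by
  refine ⟨BCol.decidableInPolyTime_hasExtension, fun G S' c' hG hS hp => ?_⟩
  rw [BCol.exists_isPerfectMatching_auxGraph_iff]
  exact BCol.hasBPrecolouringExtension_iff hG hS hp
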